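/- For positive integers $d_A,d_C$ and $\varepsilon>0$, let $\mathrm{SC}_{\mathrm{I},H}(\varepsilon,d_A,d_C)$ be the least $N$ for which there is a (possibly randomized) test that, given $N$ i.i.d. samples from an unknown probability distribution $P_{AC}$ on $\{1,\dots,d_A\}\times\{1,\dots,d_C\}$, answers "yes" with probability at least $2/3$ whenever $D_H^2(P_{AC},P_AP_C)=0$, and "no" with probability at least $2/3$ whenever $D_H^2(P_{AC},P_AP_C)\ge\varepsilon$. Here $P_A,P_C$ are the marginals of $P_{AC}$ and $D_H^2(P,Q)=\frac12\sum_x\bigl(\sqrt{P(x)}-\sqrt{Q(x)}\bigr)^2$ is the squared Hellinger distance. Then, for $d_A\ge d_C\ge 2$ and all sufficiently small $\varepsilon$, $$\mathrm{SC}_{\mathrm{I},H}(\varepsilon,d_A,d_C)=\widetilde\Omega\left(\min\left\{\frac{d_A^{3/4}d_C^{1/4}}{\varepsilon},\ \frac{d_A^{2/3}d_C^{1/3}}{\varepsilon^{4/3}}\right\}\right),$$ where $\widetilde\Omega$ hides factors that are poly-logarithmic in the parameters. That is, there are absolute constants $c>0$, $k\in\mathbb{N}$ and $\varepsilon_0\in(0,1]$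 such that for all integers $d_A\ge d_C\ge 2$ and all $0<\varepsilon\le\varepsilon_0$, $$\mathrm{SC}_{\mathrm{I},H}(\varepsilon,d_A,d_C)\ \ge\ \frac{c}{\log^{k}(d_Ad_C/\varepsilon)}\,\min\left\{\frac{d_A^{3/4}d_C^{1/4}}{\varepsilon},\ \frac{d_A^{2/3}d_C^{1/3}}{\varepsilon^{4/3}}\right\}.$$ -/

import Mathlib

open scoped ENNReal

noncomputable section

namespace IndependenceTesting

/-- Marginal `P_A` of a joint distribution `P_{AC}`. -/
def marginalA {A C : Type*} [Fintype C] (P : A × C → ℝ) (a : A) : ℝ := ∑ c, P (a, c)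

/-- Marginal `P_C` of a joint distribution `P_{AC}`. -/
def marginalC {A C : Type*} [Fintype A] (P : A × C → ℝ) (c : C) : ℝ := ∑ a, P (a, c)

/-- The product `P_A P_C` of the two marginals of `P_{AC}`. -/
def marginalProduct {A C : Type*} [Fintype A] [Fintype C] (P : A × C → ℝ) : A × C → ℝ :=
  fun x => marginalA P x.1 * marginalC P x.2

/-- Squared Hellinger distance
`D_H²(P, Q) = (1/2) ∑ x, (√(P x) - √(Q x))²` of two distributions on a finite set. -/
def hellingerSq {D : Type*} [Fintype D] (P Q : D → ℝ) : ℝ :=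
  (1 / 2) * ∑ x, (√(P x) - √(Q x)) ^ 2

/-- A (randomized) test on `N` samples from `D`: it maps the list of samples to the
probability with which the answer is "yes" ("no" has the complementary probability). -/
def RandomizedTest (D : Type*) (N : ℕ) : Type _ := (Fin N → D) → Set.Icc (0 : ℝ) 1

/-- The probability that the test answers "yes" on `N` i.i.d. samples from `P`; the randomness is
that of the samples and that of the test. -/
def yesProb {D : Type*} [Fintype D] {N : ℕ} (P : D → ℝ) (T : RandomizedTest D N) : ℝ :=
  ∑ x : Fin N → D, (∏ i, P (x i)) * (T x : ℝ)

/-- `T` is an independence tester in squared Hellinger distance with threshold `ε`: for every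
distribution `P` on `A × C`, with probability at least `2/3`, it answers "yes" if
`D_H²(P, P_A P_C) = 0` and "no" if `D_H²(P, P_A P_C) ≥ ε`. -/
def IsIndependenceTester {A C : Type*} [Fintype A] [Fintype C] {N : ℕ} (ε : ℝ)
    (T : RandomizedTest (A × C) N) : Prop :=
  ∀ P ∈ stdSimplex ℝ (A × C),
    (hellingerSq P (marginalProduct P) = 0 → 2 / 3 ≤ yesProb P T) ∧
    (ε ≤ hellingerSq P (marginalProduct P) → 2 / 3 ≤ 1 - yesProb P T)

/-- The sample complexity `SC_{I,H}(ε, d_A, d_C)`: the least `N` for which there is an independence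
tester on `N` samples (it would be `⊤` if there were none). -/
def sampleComplexity (ε : ℝ) (dA dC : ℕ) : ℕ∞ :=
  ⨅ (N : ℕ) (_ : ∃ T : RandomizedTest (Fin dA × Fin dC) N, IsIndependenceTester ε T), (N : ℕ∞)

end IndependenceTesting

end

/-! The proof is Le Cam's method with two random families of Poisson intensity matrices. One row
`a₀` has total intensity `R`, large enough that `N` samples are almost surely available. Every other
row is heavy (total `1`) with probability `p` and otherwise light (total `l`, of order `R * ε /
dA`). Under the null all rows are uniform over the columns. Under the alternative the columns are
paired, and in each light row a random sign pattern moves the mass of each pair onto one column. The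
null is a product distribution, while the emptied cells of the light rows put the alternative at
squared Hellinger distance at least `ε` (`le_hellingerSq_altIntensity`), unless too many rows are
heavy.

A single sample in a row reveals nothing about a random pattern (`meanRatio_eq_one`), so light rows
differ only through counts of at least two, whose probability is of order `l ^ 2`. Heavy rows
produce such counts too and mask them, which gives a chi-square divergence of order `l ^ 4 / (p *
m)` per row with `m` columns (`exists_row_chiSq_bound`). Rows are independent, so the families are
indistinguishable once `dA * l ^ 4 / (p * m)` is small (`mixtureAccept_sub_le`). Taking `p` of order
`min (R / dA) 1` turns this into bounds on `R ^ 3 * ε ^ 4` or `R ^ 4 * ε ^ 4`, the two terms of the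
minimum. `hasSum_acceptOfCounts` carries the conclusion back to a fixed number of samples. -/

namespace IndependenceTesting

open Finset

/-! ### Sample counts and multinomial coefficients -/

/-- The number of samples in `x` that are equal to `d`. -/
def sampleCount {D : Type*} [DecidableEq D] {M : ℕ} (x : Fin M → D) (d : D) : ℕ :=
  ∑ i, if x i = d then 1 else 0

theorem sum_sampleCount {D : Type*} [DecidableEq D] [Fintype D] {M : ℕ} (x : Fin M → D) :
    ∑ d, sampleCount x d = M := by
  simp only [sampleCount]
  rw [sum_comm]
  simp

theorem prod_apply_sample {D : Type*} [DecidableEq D] [Fintype D] {M : ℕ} (x : Fin M → D)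
    (μ : D → ℝ) : ∏ i, μ (x i) = ∏ d, μ d ^ sampleCount x d := by
  simp only [sampleCount, ← prod_pow_eq_pow_sum]
  rw [prod_comm]
  refine prod_congr rfl fun i _ => ?_
  rw [prod_eq_single (x i)] <;> simp +contextual [eq_comm]

/-- Deleting the first sample lowers one count `k d` by one, and the factor `k d` of the factorial
product then sums to `M + 1`. Only this half of the multinomial formula is needed, to keep
`acceptOfCounts` at most `1`. -/
theorem card_sampleCount_fiber_mul_le {D : Type*} [DecidableEq D] [Fintype D] (M : ℕ)
    (k : D → ℕ) :
    #{x : Fin M → D | sampleCount x = k} * ∏ d, (k d).factorial ≤ M.factorial := by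
  induction M generalizing k with
  | zero =>
    by_cases hk : k = 0
    · subst hk
      simpa using card_le_univ ({x : Fin 0 → D | sampleCount x = 0} : Finset _)
    · rw [card_eq_zero.2, zero_mul]
      · exact Nat.zero_le _
      · rw [filter_eq_empty_iff]
        intro x _ h
        exact hk (h ▸ by ext d; simp [sampleCount])
  | succ M ih =>
    by_cases hk : ∑ d, k d = M + 1
    · have hcard : #{x : Fin (M + 1) → D | sampleCount x = k} ≤
          ∑ d, if k d = 0 then 0 else
            #{x : Fin M → D | sampleCount x = Function.update k d (k d - 1)} := by
        rw [card_filter, ← (Fin.consEquiv (fun _ : Fin (M + 1) => D)).sum_comp,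
          Fintype.sum_prod_type]
        refine sum_le_sum fun d _ => ?_
        have key : ∀ x : Fin M → D, sampleCount (Fin.cons d x : Fin (M + 1) → D) = k →
            k d ≠ 0 ∧ sampleCount x = Function.update k d (k d - 1) := by
          intro x h
          have h' : ∀ e, (if d = e then 1 else 0) + sampleCount x e = k e := by
            intro e
            rw [← h]
            rw [sampleCount, sampleCount, Fin.sum_univ_succ]
            simp only [Fin.cons_zero, Fin.cons_succ]
          refine ⟨?_, ?_⟩
          · have := h' d
            simp at this
            omega
          · ext e
            have := h' e
            by_cases hde : e = d
            · subst hde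
              simp at this ⊢
              omega
            · simpa [hde, Ne.symm hde] using this
        split_ifs with h0
        · refine (sum_eq_zero fun x _ => ?_).le
          rw [if_neg]
          intro h
          exact (key x h).1 h0
        · rw [card_filter]
          refine sum_le_sum fun x _ => ?_
          change (if sampleCount (Fin.cons d x : Fin (M + 1) → D) = k then 1 else 0) ≤ _
          split_ifs with h1 h2 h2
          · exact le_rfl
          · exact absurd (key x h1).2 h2
          · exact Nat.zero_le _
          · exact le_rfl
      calc #{x : Fin (M + 1) → D | sampleCount x = k} * ∏ d, (k d).factorial
          ≤ (∑ d, if k d = 0 then 0 else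
            #{x : Fin M → D | sampleCount x = Function.update k d (k d - 1)}) *
              ∏ d, (k d).factorial := Nat.mul_le_mul_right _ hcard
        _ ≤ ∑ d, k d * M.factorial := by
          rw [sum_mul]
          refine sum_le_sum fun d _ => ?_
          split_ifs with h0
          · simp
          · have hfac : ∏ e, (k e).factorial =
                k d * ∏ e, (Function.update k d (k d - 1) e).factorial := by
              rw [← mul_prod_erase univ _ (mem_univ d),
                ← mul_prod_erase univ (fun e => (Function.update k d (k d - 1) e).factorial)
                  (mem_univ d), ← mul_assoc]
              congr 1
              · simp [Nat.mul_factorial_pred h0]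
              · refine prod_congr rfl fun e he => ?_
                rw [Function.update_of_ne (ne_of_mem_erase he)]
            rw [hfac, mul_left_comm]
            exact Nat.mul_le_mul_left _ (ih _)
        _ = (M + 1).factorial := by rw [← sum_mul, hk, Nat.factorial_succ]
    · rw [card_eq_zero.2, zero_mul]
      · exact Nat.zero_le _
      · rw [filter_eq_empty_iff]
        intro x _ h
        exact hk (h ▸ sum_sampleCount x)

/-! ### Product series and Poisson weights -/

theorem hasSum_mul_of_nonneg {E F : Type*} {f : E → ℝ} {g : F → ℝ} {s t : ℝ}
    (hf : ∀ e, 0 ≤ f e) (hg : ∀ e, 0 ≤ g e) (h : HasSum f s) (h' : HasSum g t) :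
    HasSum (fun x : E × F => f x.1 * g x.2) (s * t) :=
  HasSum.mul h h' (Summable.mul_of_nonneg h.summable h'.summable hf hg)

theorem hasSum_pi_prod_of_nonneg {ι E : Type*} [Fintype ι] {f : ι → E → ℝ} {s : ι → ℝ}
    (hf : ∀ i e, 0 ≤ f i e) (h : ∀ i, HasSum (f i) (s i)) :
    HasSum (fun k : ι → E => ∏ i, f i (k i)) (∏ i, s i) := by
  have fin_case : ∀ (n : ℕ) (f : Fin n → E → ℝ) (s : Fin n → ℝ), (∀ i e, 0 ≤ f i e) →
      (∀ i, HasSum (f i) (s i)) → HasSum (fun k : Fin n → E => ∏ i, f i (k i)) (∏ i, s i) := by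
    intro n
    induction n with
    | zero =>
      intro f s _ _
      simp
    | succ n ih =>
      intro f s hf h
      have h1 := ih (fun i => f i.succ) (fun i => s i.succ) (fun i => hf _) (fun i => h _)
      have h2 := hasSum_mul_of_nonneg (hf 0) (fun k => prod_nonneg fun i _ => hf (Fin.succ i) (k i))
        (h 0) h1
      rw [← (Fin.consEquiv (fun _ : Fin (n + 1) => E)).hasSum_iff, Fin.prod_univ_succ]
      have e : (fun k : Fin (n + 1) → E => ∏ i, f i (k i)) ∘ Fin.consEquiv (fun _ => E) =
          fun x : E × (Fin n → E) => f 0 x.1 * ∏ i : Fin n, f i.succ (x.2 i) := by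
        ext x
        simp [Fin.prod_univ_succ]
      rw [e]
      exact h2
  let e := Fintype.equivFin ι
  have := fin_case _ (fun i => f (e.symm i)) (fun i => s (e.symm i)) (fun i => hf _)
    (fun i => h _)
  rw [← (e.symm.arrowCongr (Equiv.refl E)).hasSum_iff, ← e.symm.prod_comp]
  convert this using 1
  ext k
  simp only [Function.comp]
  rw [← e.symm.prod_comp]
  simp

/-- The probability that a Poisson variable of mean `x` equals `n`. -/
noncomputable def poissonWeight (x : ℝ) (n : ℕ) : ℝ := Real.exp (-x) * x ^ n / n.factorial

theorem poissonWeight_nonneg {x : ℝ} (hx : 0 ≤ x) (n : ℕ) : 0 ≤ poissonWeight x n := by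
  unfold poissonWeight
  positivity

theorem hasSum_poissonWeight_mul_pow (x y : ℝ) :
    HasSum (fun n => poissonWeight x n * y ^ n) (Real.exp (x * (y - 1))) := by
  have h := (NormedSpace.expSeries_div_hasSum_exp (x * y)).mul_left (Real.exp (-x))
  rw [← Real.exp_eq_exp_ℝ, ← Real.exp_add] at h
  have e : x * (y - 1) = -x + x * y := by ring
  rw [e]
  have e' : (fun n => poissonWeight x n * y ^ n) =
      fun n : ℕ => Real.exp (-x) * ((x * y) ^ n / n.factorial) := by
    ext n
    rw [poissonWeight, mul_pow]
    ring
  rw [e']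
  exact h

theorem hasSum_poissonWeight (x : ℝ) : HasSum (poissonWeight x) 1 := by
  simpa using hasSum_poissonWeight_mul_pow x 1

/-- A Chernoff bound: halving the mean costs a factor at most `2 ^ N * exp (-(x / 2))` on counts
below `N`, and this is at most `exp (-5)`. -/
theorem sum_poissonWeight_lt_le {x : ℝ} (hx : 0 ≤ x) {N : ℕ} (h : 2 * (N : ℝ) + 10 ≤ x) :
    ∑ M ∈ range N, poissonWeight x M ≤ 1 / 30 := by
  have h1 : ∀ M ∈ range N, poissonWeight x M ≤
      (2 ^ N * Real.exp (-(x / 2))) * poissonWeight (x / 2) M := by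
    intro M hM
    have : (2 : ℝ) ^ M ≤ 2 ^ N := pow_le_pow_right₀ (by norm_num) (mem_range.1 hM).le
    have e : Real.exp (-x) = Real.exp (-(x / 2)) * Real.exp (-(x / 2)) := by
      rw [← Real.exp_add]
      congr 1
      ring
    calc poissonWeight x M = (2 ^ M * Real.exp (-(x / 2))) * poissonWeight (x / 2) M := by
          rw [poissonWeight, poissonWeight, e, div_pow]
          field_simp
      _ ≤ _ := by
          gcongr
          exact poissonWeight_nonneg (by positivity) _
  calc ∑ M ∈ range N, poissonWeight x M
      ≤ ∑ M ∈ range N, (2 ^ N * Real.exp (-(x / 2))) * poissonWeight (x / 2) M := sum_le_sum h1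
    _ = (2 ^ N * Real.exp (-(x / 2))) * ∑ M ∈ range N, poissonWeight (x / 2) M := by
        rw [mul_sum]
    _ ≤ (2 ^ N * Real.exp (-(x / 2))) * 1 := by
        gcongr
        exact sum_le_hasSum _ (fun n _ => poissonWeight_nonneg (by positivity) n)
          (hasSum_poissonWeight _)
    _ ≤ Real.exp (N : ℝ) * Real.exp (-(x / 2)) := by
        rw [mul_one]
        gcongr
        rw [← Real.exp_one_pow]
        gcongr
        have := Real.add_one_le_exp (1 : ℝ)
        linarith
    _ ≤ Real.exp (-5) := by
        rw [← Real.exp_add]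
        gcongr
        linarith
    _ ≤ 1 / 30 := by
        rw [Real.exp_neg, one_div]
        have h2 : (2 : ℝ) ≤ Real.exp 1 := by
          have := Real.add_one_le_exp (1 : ℝ)
          linarith
        have h3 : (2 : ℝ) ^ 5 ≤ Real.exp 5 := by
          have : Real.exp 5 = Real.exp 1 ^ 5 := by rw [← Real.exp_nat_mul]; norm_num
          rw [this]
          gcongr
        gcongr
        linarith

/-! ### Poissonization of a test -/

theorem sum_prod_mul_castLE {D : Type*} [Fintype D] {N M : ℕ} (h : N ≤ M) {P : D → ℝ}
    (hP : ∑ d, P d = 1) (g : (Fin N → D) → ℝ) :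
    ∑ x : Fin M → D, (∏ i, P (x i)) * g (fun i => x (Fin.castLE h i)) =
      ∑ y : Fin N → D, (∏ i, P (y i)) * g y := by
  classical
  obtain ⟨j, rfl⟩ := Nat.exists_eq_add_of_le h
  rw [← (Fin.appendEquiv N j).sum_comp, Fintype.sum_prod_type]
  refine sum_congr rfl fun y _ => ?_
  have hz : ∑ z : Fin j → D, ∏ i, P (z i) = 1 := by
    have := prod_univ_sum (fun _ : Fin j => (univ : Finset D)) (fun _ d => P d)
    rw [Fintype.piFinset_univ] at this
    rw [← this]
    simp [hP]
  have : ∀ z : Fin j → D, (∏ i, P (Fin.appendEquiv N j (y, z) i)) *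
      g (fun i => Fin.appendEquiv N j (y, z) (Fin.castLE h i)) =
      ((∏ i, P (y i)) * g y) * ∏ i, P (z i) := by
    intro z
    have e1 : (fun i => Fin.appendEquiv N j (y, z) (Fin.castLE h i)) = y := by
      ext i
      change Fin.append y z (Fin.castAdd j i) = y i
      simp
    rw [e1, Fin.prod_univ_add]
    simp only [Fin.appendEquiv, Equiv.coe_fn_mk, Fin.append_left, Fin.append_right]
    ring
  simp only [this]
  rw [← mul_sum, hz, mul_one]

/-- The probability that the test accepts a uniformly random ordering of a collection of samples
with counts `k`, only the first `N` samples being used; it is `0` if there are fewer than `N`. -/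
noncomputable def acceptOfCounts {D : Type*} [DecidableEq D] [Fintype D] {N : ℕ}
    (T : RandomizedTest D N) (k : D → ℕ) : ℝ :=
  if h : N ≤ ∑ d, k d then
    ((∏ d, (k d).factorial : ℕ) : ℝ) / (∑ d, k d).factorial *
      ∑ x : Fin (∑ d, k d) → D with sampleCount x = k, (T (fun i => x (Fin.castLE h i)) : ℝ)
  else 0

section acceptOfCounts

variable {D : Type*} [DecidableEq D] [Fintype D] {N : ℕ} (T : RandomizedTest D N)

theorem acceptOfCounts_nonneg (k : D → ℕ) : 0 ≤ acceptOfCounts T k := by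
  unfold acceptOfCounts
  split_ifs with h
  · exact mul_nonneg (by positivity) (sum_nonneg fun x _ => (T _).2.1)
  · exact le_rfl

theorem acceptOfCounts_le_one (k : D → ℕ) : acceptOfCounts T k ≤ 1 := by
  unfold acceptOfCounts
  split_ifs with h
  · have h1 : ∑ x : Fin (∑ d, k d) → D with sampleCount x = k,
        (T (fun i => x (Fin.castLE h i)) : ℝ) ≤
        #{x : Fin (∑ d, k d) → D | sampleCount x = k} := by
      rw [card_eq_sum_ones, Nat.cast_sum, Nat.cast_one]
      exact sum_le_sum fun x _ => (T _).2.2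
    have h2 : ((#{x : Fin (∑ d, k d) → D | sampleCount x = k} *
        ∏ d, (k d).factorial : ℕ) : ℝ) ≤ ((∑ d, k d).factorial : ℕ) :=
      Nat.cast_le.2 (card_sampleCount_fiber_mul_le _ k)
    rw [Nat.cast_mul] at h2
    rw [div_mul_eq_mul_div, div_le_one (by positivity)]
    refine le_trans ?_ h2
    rw [mul_comm]
    gcongr
  · exact zero_le_one

/-- Given their total, independent Poisson counts are those of i.i.d. samples: the factorials of the
Poisson weights cancel against those in `acceptOfCounts`. -/
theorem sum_acceptOfCounts_fiber {M : ℕ} (μ : D → ℝ) (s : Finset (D → ℕ))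
    (hs : ∀ k, k ∈ s ↔ ∑ d, k d = M) :
    ∑ k ∈ s, (∏ d, poissonWeight (μ d) (k d)) * acceptOfCounts T k =
      if h : N ≤ M then Real.exp (-∑ d, μ d) / M.factorial *
        ∑ x : Fin M → D, (∏ i, μ (x i)) * (T (fun i => x (Fin.castLE h i)) : ℝ) else 0 := by
  split_ifs with h
  · have hmaps : ∀ x ∈ (univ : Finset (Fin M → D)), sampleCount x ∈ s :=
      fun x _ => (hs _).2 (sum_sampleCount x)
    rw [← sum_fiberwise_of_maps_to hmaps, mul_sum]
    refine sum_congr rfl fun k hk => ?_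
    obtain rfl := (hs k).1 hk
    rw [acceptOfCounts, dif_pos h]
    have e1 : ∏ d, poissonWeight (μ d) (k d) =
        Real.exp (-∑ d, μ d) * (∏ d, μ d ^ k d) / ((∏ d, (k d).factorial : ℕ) : ℝ) := by
      simp only [poissonWeight]
      rw [prod_div_distrib, prod_mul_distrib, ← Real.exp_sum, sum_neg_distrib]
      push_cast
      rfl
    have e2 : ∑ x : Fin (∑ d, k d) → D with sampleCount x = k,
        (∏ i, μ (x i)) * (T (fun i => x (Fin.castLE h i)) : ℝ) =
        (∏ d, μ d ^ k d) * ∑ x : Fin (∑ d, k d) → D with sampleCount x = k,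
          (T (fun i => x (Fin.castLE h i)) : ℝ) := by
      rw [mul_sum]
      refine sum_congr rfl fun x hx => ?_
      rw [prod_apply_sample, (mem_filter.1 hx).2]
    rw [e1, e2]
    have : ((∏ d, (k d).factorial : ℕ) : ℝ) ≠ 0 := by
      rw [Nat.cast_ne_zero]
      exact prod_ne_zero_iff.2 fun d _ => Nat.factorial_ne_zero _
    field_simp
  · refine sum_eq_zero fun k hk => ?_
    rw [acceptOfCounts, dif_neg, mul_zero]
    rwa [(hs k).1 hk]

/-- Poissonization: with independent Poisson counts of means `μ d`, the test accepts with its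
acceptance probability at the normalized distribution times the probability that at least `N`
samples are available. -/
theorem hasSum_acceptOfCounts {μ : D → ℝ} (hμ : ∀ d, 0 ≤ μ d) (hpos : 0 < ∑ d, μ d) :
    HasSum (fun k : D → ℕ => (∏ d, poissonWeight (μ d) (k d)) * acceptOfCounts T k)
      (yesProb (fun d => μ d / ∑ e, μ e) T *
        (1 - ∑ M ∈ range N, poissonWeight (∑ d, μ d) M)) := by
  set Z := ∑ d, μ d with hZ
  set y := yesProb (fun d => μ d / Z) T with hy
  have hnn : ∀ k : D → ℕ, 0 ≤ ∏ d, poissonWeight (μ d) (k d) := fun k =>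
    prod_nonneg fun d _ => poissonWeight_nonneg (hμ d) _
  have hsum1 : HasSum (fun k : D → ℕ => ∏ d, poissonWeight (μ d) (k d)) 1 := by
    have := hasSum_pi_prod_of_nonneg (fun d n => poissonWeight_nonneg (hμ d) n)
      (fun d => hasSum_poissonWeight (μ d))
    simpa using this
  have hsum : Summable fun k : D → ℕ => (∏ d, poissonWeight (μ d) (k d)) * acceptOfCounts T k :=
    Summable.of_nonneg_of_le (fun k => mul_nonneg (hnn k) (acceptOfCounts_nonneg T k))
      (fun k => mul_le_of_le_one_right (hnn k) (acceptOfCounts_le_one T k)) hsum1.summable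
  have hlevel : ∀ M : ℕ, HasSum (fun k : {k : D → ℕ // ∑ d, k d = M} =>
      (∏ d, poissonWeight (μ d) (k.1 d)) * acceptOfCounts T k.1)
      (if N ≤ M then y * poissonWeight Z M else 0) := by
    intro M
    have hs : ∀ k : D → ℕ, k ∈ piAntidiag univ M ↔ ∑ d, k d = M := by
      intro k
      simp [mem_piAntidiag]
    have hval := sum_acceptOfCounts_fiber T μ (piAntidiag univ M) hs
    have hrhs : (if h : N ≤ M then Real.exp (-∑ d, μ d) / M.factorial *
        ∑ x : Fin M → D, (∏ i, μ (x i)) * (T (fun i => x (Fin.castLE h i)) : ℝ) else 0) =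
        if N ≤ M then y * poissonWeight Z M else 0 := by
      split_ifs with h
      · have hP : ∑ d, μ d / Z = 1 := by rw [← sum_div, div_self hpos.ne']
        have := sum_prod_mul_castLE h hP (fun x => (T x : ℝ))
        have hy' : y = (∑ x : Fin M → D,
            (∏ i, μ (x i)) * (T (fun i => x (Fin.castLE h i)) : ℝ)) / Z ^ M := by
          rw [hy, yesProb, ← this, sum_div]
          refine sum_congr rfl fun x _ => ?_
          rw [prod_div_distrib, prod_const, card_univ, Fintype.card_fin]
          ring
        rw [hy', poissonWeight, ← hZ]
        have : Z ^ M ≠ 0 := pow_ne_zero _ hpos.ne'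
        field_simp
      · rfl
    rw [hrhs] at hval
    have : Fintype {k : D → ℕ // ∑ d, k d = M} := Fintype.subtype (piAntidiag univ M) hs
    rw [← hval, sum_subtype _ hs]
    exact hasSum_fintype _
  -- The count vectors are grouped by their total `M`.
  have h1 := ((Equiv.sigmaFiberEquiv fun k : D → ℕ => ∑ d, k d).hasSum_iff.2 hsum.hasSum).sigma
    hlevel
  have h2 : HasSum (fun M => if N ≤ M then y * poissonWeight Z M else 0)
      (y * (1 - ∑ M ∈ range N, poissonWeight Z M)) := by
    have h3 := (hasSum_poissonWeight Z).sub
      (hasSum_sum_of_ne_finset_zero (f := fun M => if M < N then poissonWeight Z M else 0)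
        (s := range N) (fun b hb => if_neg (by simpa using hb)))
    have h4 := h3.mul_left y
    rw [sum_congr rfl (fun M hM => if_pos (mem_range.1 hM))] at h4
    have e : (fun M => if N ≤ M then y * poissonWeight Z M else 0) = fun M =>
        y * (poissonWeight Z M - if M < N then poissonWeight Z M else 0) := by
      ext M
      by_cases hM : N ≤ M
      · simp [hM, not_lt.2 hM]
      · simp [hM, not_le.1 hM]
    rw [e]
    exact h4
  rw [← h1.unique h2]
  exact hsum.hasSum

end acceptOfCounts

/-! ### Mixtures with independent rows -/

theorem sum_pi_prod {ι Ω : Type*} [Fintype ι] [Fintype Ω] [DecidableEq ι] (f : ι → Ω → ℝ) :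
    ∑ ω : ι → Ω, ∏ i, f i (ω i) = ∏ i, ∑ o, f i o := by
  rw [prod_univ_sum, Fintype.piFinset_univ]

/-- The law of the counts in a row whose independent Poisson entries have means `v ω`, with `ω`
drawn from `π`. -/
noncomputable def rowLaw {C Ω : Type*} [Fintype C] [Fintype Ω] (π : Ω → ℝ) (v : Ω → C → ℝ)
    (κ : C → ℕ) : ℝ :=
  ∑ ω, π ω * ∏ c, poissonWeight (v ω c) (κ c)

section mixture

variable {A C Ω : Type*} [Fintype A] [Fintype C] [Fintype Ω] {N : ℕ} {π : Ω → ℝ}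

theorem rowLaw_nonneg (hπ : ∀ ω, 0 ≤ π ω) {v : Ω → C → ℝ} (hv : ∀ ω c, 0 ≤ v ω c) (κ : C → ℕ) :
    0 ≤ rowLaw π v κ :=
  sum_nonneg fun ω _ => mul_nonneg (hπ ω) (prod_nonneg fun c _ => poissonWeight_nonneg (hv ω c) _)

theorem hasSum_rowLaw (hπ1 : ∑ ω, π ω = 1) {v : Ω → C → ℝ}
    (hv : ∀ ω c, 0 ≤ v ω c) : HasSum (rowLaw π v) 1 := by
  have h : ∀ ω, HasSum (fun κ : C → ℕ => π ω * ∏ c, poissonWeight (v ω c) (κ c)) (π ω) := by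
    intro ω
    have := (hasSum_pi_prod_of_nonneg (fun c n => poissonWeight_nonneg (hv ω c) n)
      (fun c => hasSum_poissonWeight (v ω c))).mul_left (π ω)
    simpa using this
  have := hasSum_sum (s := univ) fun ω _ => h ω
  rw [hπ1] at this
  exact this

variable [DecidableEq A] [DecidableEq C]

/-- The acceptance probability of a test in the Poissonized model in which the rows of the
intensity matrix are drawn independently: row `a` is `v a ω` with `ω` drawn from `π`. -/
noncomputable def mixtureAccept (T : RandomizedTest (A × C) N) (π : Ω → ℝ)
    (v : A → Ω → C → ℝ) : ℝ :=
  ∑ ω : A → Ω, (∏ a, π (ω a)) *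
    (yesProb (fun d : A × C => v d.1 (ω d.1) d.2 / ∑ e : A × C, v e.1 (ω e.1) e.2) T *
      (1 - ∑ M ∈ range N, poissonWeight (∑ d : A × C, v d.1 (ω d.1) d.2) M))

theorem hasSum_mixtureAccept (T : RandomizedTest (A × C) N) {v : A → Ω → C → ℝ}
    (hv : ∀ a ω c, 0 ≤ v a ω c) (hpos : ∀ ω : A → Ω, 0 < ∑ d : A × C, v d.1 (ω d.1) d.2) :
    HasSum (fun k : A → C → ℕ =>
      (∏ a, rowLaw π (v a) (k a)) * acceptOfCounts T (fun d => k d.1 d.2))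
      (mixtureAccept T π v) := by
  have h1 : ∀ ω : A → Ω, HasSum (fun k : A → C → ℕ =>
      (∏ a, π (ω a)) * ((∏ a, ∏ c, poissonWeight (v a (ω a) c) (k a c)) *
        acceptOfCounts T (fun d => k d.1 d.2))) ((∏ a, π (ω a)) *
    (yesProb (fun d : A × C => v d.1 (ω d.1) d.2 / ∑ e : A × C, v e.1 (ω e.1) e.2) T *
      (1 - ∑ M ∈ range N, poissonWeight (∑ d : A × C, v d.1 (ω d.1) d.2) M))) := by
    intro ω
    have h2 := hasSum_acceptOfCounts T (μ := fun d : A × C => v d.1 (ω d.1) d.2)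
      (fun d => hv _ _ _) (hpos ω)
    rw [← (Equiv.curry A C ℕ).symm.hasSum_iff] at h2
    have e : (fun k : A × C → ℕ => (∏ d : A × C, poissonWeight (v d.1 (ω d.1) d.2) (k d)) *
        acceptOfCounts T k) ∘ (Equiv.curry A C ℕ).symm = fun k : A → C → ℕ =>
        (∏ a, ∏ c, poissonWeight (v a (ω a) c) (k a c)) *
        acceptOfCounts T (fun d => k d.1 d.2) := by
      ext k
      simp only [Function.comp, Fintype.prod_prod_type]
      rfl
    rw [e] at h2
    exact h2.mul_left _
  have h3 := hasSum_sum (s := univ) fun ω _ => h1 ω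
  have e : (fun k : A → C → ℕ =>
      (∏ a, rowLaw π (v a) (k a)) * acceptOfCounts T (fun d => k d.1 d.2)) = fun k =>
      ∑ ω : A → Ω, (∏ a, π (ω a)) * ((∏ a, ∏ c, poissonWeight (v a (ω a) c) (k a c)) *
        acceptOfCounts T (fun d => k d.1 d.2)) := by
    ext k
    simp only [rowLaw]
    rw [← sum_pi_prod (fun a o => π o * ∏ c, poissonWeight (v a o c) (k a c)), sum_mul]
    refine sum_congr rfl fun ω _ => ?_
    rw [prod_mul_distrib, mul_assoc]
  rw [e]
  exact h3

/-- Here `u` dominates `q₁ ^ 2 / q₀`. The AM-GM inequality `(q₀ - 5 * d) ^ 2 ≥ 0` replaces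
Cauchy-Schwarz by a bound linear in `q₀`, `q₁`, `u`, which can be summed term by term. -/
theorem sub_mul_le_of_sq_le {q₀ q₁ u g : ℝ} (hq : 0 < q₀) (hu : q₁ ^ 2 ≤ u * q₀) (hg0 : 0 ≤ g)
    (hg1 : g ≤ 1) : (q₀ - q₁) * g ≤ (1 / 10) * q₀ + (5 / 2) * (u - 2 * q₁ + q₀) := by
  have h1 : (q₀ - q₁) * g ≤ |q₀ - q₁| := by
    calc (q₀ - q₁) * g ≤ |q₀ - q₁| * g := by gcongr; exact le_abs_self _
      _ ≤ _ := mul_le_of_le_one_right (abs_nonneg _) hg1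
  refine h1.trans ?_
  have h2 : |q₀ - q₁| ^ 2 ≤ (u - 2 * q₁ + q₀) * q₀ := by
    rw [sq_abs]
    nlinarith
  set d := |q₀ - q₁|
  refine le_of_mul_le_mul_right ?_ hq
  nlinarith [sq_nonneg (q₀ - 5 * d)]

/-- A chi-square bound on the rows bounds the difference of the acceptance probabilities. -/
theorem mixtureAccept_sub_le (T : RandomizedTest (A × C) N) (hπ1 : ∑ ω, π ω = 1)
    (hπ : ∀ ω, 0 ≤ π ω) {v₀ v₁ : A → Ω → C → ℝ}
    (hv₀ : ∀ a ω c, 0 ≤ v₀ a ω c) (hv₁ : ∀ a ω c, 0 ≤ v₁ a ω c)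
    (hpos₀ : ∀ ω : A → Ω, 0 < ∑ d : A × C, v₀ d.1 (ω d.1) d.2)
    (hpos₁ : ∀ ω : A → Ω, 0 < ∑ d : A × C, v₁ d.1 (ω d.1) d.2)
    (hq : ∀ a κ, 0 < rowLaw π (v₀ a) κ) {u : A → (C → ℕ) → ℝ} {S : A → ℝ}
    (hu : ∀ a κ, rowLaw π (v₁ a) κ ^ 2 ≤ u a κ * rowLaw π (v₀ a) κ)
    (hS : ∀ a, HasSum (u a) (S a)) (hSprod : ∏ a, S a ≤ 1 + 1 / 25) :
    mixtureAccept T π v₀ - mixtureAccept T π v₁ ≤ 1 / 5 := by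
  have hu0 : ∀ a κ, 0 ≤ u a κ := fun a κ =>
    nonneg_of_mul_nonneg_left ((sq_nonneg _).trans (hu a κ)) (hq a κ)
  have h0 := hasSum_mixtureAccept (π := π) T hv₀ hpos₀
  have h1 := hasSum_mixtureAccept (π := π) T hv₁ hpos₁
  have s0 : HasSum (fun k : A → C → ℕ => ∏ a, rowLaw π (v₀ a) (k a)) 1 := by
    simpa using hasSum_pi_prod_of_nonneg (fun a => rowLaw_nonneg hπ (hv₀ a))
      (fun a => hasSum_rowLaw hπ1 (hv₀ a))
  have s1 : HasSum (fun k : A → C → ℕ => ∏ a, rowLaw π (v₁ a) (k a)) 1 := by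
    simpa using hasSum_pi_prod_of_nonneg (fun a => rowLaw_nonneg hπ (hv₁ a))
      (fun a => hasSum_rowLaw hπ1 (hv₁ a))
  have s2 := hasSum_pi_prod_of_nonneg hu0 hS
  -- The total is `1 / 10 + (5 / 2) * (∏ a, S a - 1)`, at most `1 / 5`.
  have hb := (s0.mul_left (1 / 10)).add (((s2.sub (s1.mul_left 2)).add s0).mul_left (5 / 2))
  have := hasSum_le (fun k => ?_) (h0.sub h1) hb
  · refine this.trans ?_
    linarith
  · rw [← sub_mul]
    refine sub_mul_le_of_sq_le (prod_pos fun a _ => hq _ _) ?_ (acceptOfCounts_nonneg T _)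
      (acceptOfCounts_le_one T _)
    rw [← prod_pow, ← prod_mul_distrib]
    exact prod_le_prod (fun a _ => sq_nonneg _) fun a _ => hu _ _

end mixture

/-! ### Sign patterns and the chi-square divergence of one row -/

section pattern

variable {K : Type*} [Fintype K]

/-- The factor by which the sign pattern `r` modulates the mass of the column `c`: of the two
columns over `c.1`, one is doubled and the other one is emptied. -/
def columnFactor (r : K → Bool) (c : K × Bool) : ℝ := if r c.1 = c.2 then 2 else 0

theorem columnFactor_nonneg {K : Type*} (r : K → Bool) (c : K × Bool) : 0 ≤ columnFactor r c := by
  unfold columnFactor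
  split_ifs <;> norm_num

theorem sum_columnFactor_sub_one (r : K → Bool) : ∑ c, (columnFactor r c - 1) = 0 := by
  rw [Fintype.sum_prod_type]
  refine sum_eq_zero fun k _ => ?_
  rw [Fintype.sum_bool]
  cases h : r k <;> simp [columnFactor, h] <;> norm_num

theorem sum_columnFactor (r : K → Bool) :
    ∑ c, columnFactor r c = Fintype.card (K × Bool) := by
  have := sum_columnFactor_sub_one r
  rw [sum_sub_distrib] at this
  simp only [sum_const, card_univ, nsmul_eq_mul, mul_one] at this
  linarith

/-- The average over the sign patterns of the likelihood ratio of the counts `κ`. -/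
noncomputable def meanRatio [DecidableEq K] (κ : K × Bool → ℕ) : ℝ :=
  (∑ r : K → Bool, ∏ c, columnFactor r c ^ κ c) / 2 ^ Fintype.card K

/-- A single column factor is `2` or `0` with equal probability, so its mean is `1`. This gains the
exponent `4` of `l` in the row bound. -/
theorem meanRatio_eq_one [DecidableEq K] {κ : K × Bool → ℕ} (h : ∑ c, κ c ≤ 1) :
    meanRatio κ = 1 := by
  have h1 : ∀ r : K → Bool, ∏ c, columnFactor r c ^ κ c =
      ∏ k, ((if r k = true then (2 : ℝ) else 0) ^ κ (k, true) *
        (if r k = false then (2 : ℝ) else 0) ^ κ (k, false)) := by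
    intro r
    rw [Fintype.prod_prod_type]
    simp [columnFactor]
  have h2 : ∑ r : K → Bool, ∏ c, columnFactor r c ^ κ c = 2 ^ Fintype.card K := by
    simp only [h1]
    rw [sum_pi_prod (fun k (b : Bool) => (if b = true then (2 : ℝ) else 0) ^ κ (k, true) *
        (if b = false then (2 : ℝ) else 0) ^ κ (k, false)), ← card_univ]
    refine prod_eq_pow_card fun k _ => ?_
    have hk : κ (k, true) + κ (k, false) ≤ 1 := by
      refine le_trans ?_ h
      rw [Fintype.sum_prod_type]
      refine le_trans (le_of_eq ?_) (single_le_sum (fun _ _ => Nat.zero_le _) (mem_univ k))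
      rw [Fintype.sum_bool]
    obtain ⟨ht, hf⟩ | ⟨ht, hf⟩ | ⟨ht, hf⟩ : (κ (k, true) = 0 ∧ κ (k, false) = 0) ∨
        (κ (k, true) = 1 ∧ κ (k, false) = 0) ∨ (κ (k, true) = 0 ∧ κ (k, false) = 1) := by omega
    all_goals simp [ht, hf]
  rw [meanRatio, h2, div_self (by positivity)]

theorem hasSum_prod_poissonWeight_mul_pow {C : Type*} [Fintype C] {x : ℝ} (hx : 0 ≤ x)
    {y : C → ℝ} (hy : ∀ c, 0 ≤ y c) :
    HasSum (fun κ : C → ℕ => (∏ c, poissonWeight x (κ c)) * ∏ c, y c ^ κ c)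
      (Real.exp (x * ∑ c, (y c - 1))) := by
  have := hasSum_pi_prod_of_nonneg (f := fun c n => poissonWeight x n * y c ^ n)
    (fun c n => mul_nonneg (poissonWeight_nonneg hx n) (pow_nonneg (hy c) n))
    (fun c => hasSum_poissonWeight_mul_pow x (y c))
  rw [← Real.exp_sum, ← mul_sum] at this
  simpa only [prod_mul_distrib] using this

theorem hasSum_mul_meanRatio [DecidableEq K] {x : ℝ} (hx : 0 ≤ x) :
    HasSum (fun κ : K × Bool → ℕ => (∏ c, poissonWeight x (κ c)) * meanRatio κ) 1 := by
  have h := (hasSum_sum (s := univ) fun (r : K → Bool) _ =>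
    hasSum_prod_poissonWeight_mul_pow hx (columnFactor_nonneg r)).div_const
      (2 ^ Fintype.card K)
  have e : (∑ r : K → Bool, Real.exp (x * ∑ c, (columnFactor r c - 1))) / 2 ^ Fintype.card K
      = 1 := by
    simp only [sum_columnFactor_sub_one]
    simp
  rw [e] at h
  have e' : (fun κ : K × Bool → ℕ => (∏ c, poissonWeight x (κ c)) * meanRatio κ) = fun κ =>
      (∑ r : K → Bool, (∏ c, poissonWeight x (κ c)) * ∏ c, columnFactor r c ^ κ c) /
        2 ^ Fintype.card K := by
    ext κ
    rw [meanRatio, ← mul_sum, mul_div_assoc]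
  rw [e']
  exact h

theorem sum_columnFactor_mul_sub_one (r r' : K → Bool) :
    ∑ c, (columnFactor r c * columnFactor r' c - 1) =
      ∑ k, if r k = r' k then (2 : ℝ) else -2 := by
  rw [Fintype.sum_prod_type]
  refine sum_congr rfl fun k _ => ?_
  rw [Fintype.sum_bool]
  cases h : r k <;> cases h' : r' k <;> simp [columnFactor, h, h'] <;> norm_num

/-- The square is an average over two independent patterns. The Poisson generating function gives
`exp (2 * x)` for each pair where they agree and `exp (-2 * x)` where they differ; averaging yields
one `cosh` per pair. -/
theorem hasSum_mul_meanRatio_sq [DecidableEq K] {x : ℝ} (hx : 0 ≤ x) :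
    HasSum (fun κ : K × Bool → ℕ => (∏ c, poissonWeight x (κ c)) * meanRatio κ ^ 2)
      (Real.cosh (2 * x) ^ Fintype.card K) := by
  have h := (hasSum_sum (s := univ) fun (r' : K → Bool) _ =>
    hasSum_sum (s := univ) fun (r : K → Bool) _ =>
    hasSum_prod_poissonWeight_mul_pow hx (y := fun c => columnFactor r c * columnFactor r' c)
      (fun c => mul_nonneg (columnFactor_nonneg r c) (columnFactor_nonneg r' c))).div_const
      ((2 ^ Fintype.card K) ^ 2)
  have e : (∑ r' : K → Bool, ∑ r : K → Bool,
      Real.exp (x * ∑ c, (columnFactor r c * columnFactor r' c - 1))) / (2 ^ Fintype.card K) ^ 2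
      = Real.cosh (2 * x) ^ Fintype.card K := by
    have h1 : ∀ r' : K → Bool, ∑ r : K → Bool,
        Real.exp (x * ∑ c, (columnFactor r c * columnFactor r' c - 1)) =
        (2 * Real.cosh (2 * x)) ^ Fintype.card K := by
      intro r'
      simp only [sum_columnFactor_mul_sub_one, mul_sum, Real.exp_sum]
      rw [sum_pi_prod (fun k (b : Bool) => Real.exp (x * if b = r' k then (2 : ℝ) else -2)),
        ← card_univ]
      refine prod_eq_pow_card fun k _ => ?_
      rw [Real.cosh_eq, Fintype.sum_bool]
      have e1 : x * 2 = 2 * x := by ring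
      have e2 : x * -2 = -(2 * x) := by ring
      cases r' k <;> simp [e1, e2] <;> ring
    simp only [h1, sum_const, card_univ, nsmul_eq_mul, Fintype.card_fun, Fintype.card_bool]
    push_cast
    rw [mul_pow]
    field_simp
  rw [e] at h
  have e' : (fun κ : K × Bool → ℕ => (∏ c, poissonWeight x (κ c)) * meanRatio κ ^ 2) = fun κ =>
      (∑ r' : K → Bool, ∑ r : K → Bool, (∏ c, poissonWeight x (κ c)) *
        ∏ c, (columnFactor r c * columnFactor r' c) ^ κ c) / (2 ^ Fintype.card K) ^ 2 := by
    ext κ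
    rw [meanRatio, div_pow, ← mul_div_assoc, sq (∑ r : K → Bool, _), sum_mul_sum, sum_comm,
      mul_sum]
    simp only [mul_pow, prod_mul_distrib, mul_sum]
  rw [e']
  exact h

/-- A row is heavy with probability `p`; otherwise it is light. Its sign pattern is uniform. -/
noncomputable def rowPrior (p : ℝ) (ω : Bool × (K → Bool)) : ℝ :=
  (if ω.1 then p else 1 - p) / 2 ^ Fintype.card K

/-- The intensities of a row under the null hypothesis: a heavy row has total intensity `1`, a
light row has total intensity `l`, and the columns are uniform. -/
noncomputable def nullRow (l : ℝ) (ω : Bool × (K → Bool)) (_ : K × Bool) : ℝ :=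
  if ω.1 then 1 / Fintype.card (K × Bool) else l / Fintype.card (K × Bool)

/-- The intensities of a row under the alternative: light rows are modulated by their pattern. -/
noncomputable def altRow (l : ℝ) (ω : Bool × (K → Bool)) (c : K × Bool) : ℝ :=
  if ω.1 then 1 / Fintype.card (K × Bool)
  else l / Fintype.card (K × Bool) * columnFactor ω.2 c

theorem rowPrior_nonneg {p : ℝ} (h0 : 0 ≤ p) (h1 : p ≤ 1) (ω : Bool × (K → Bool)) :
    0 ≤ rowPrior p ω := by
  unfold rowPrior
  have : 0 ≤ 1 - p := by linarith
  split_ifs <;> positivity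

theorem sum_rowPrior [DecidableEq K] (p : ℝ) : ∑ ω : Bool × (K → Bool), rowPrior p ω = 1 := by
  simp only [rowPrior]
  rw [Fintype.sum_prod_type]
  simp
  field_simp
  ring

theorem nullRow_nonneg {l : ℝ} (hl : 0 ≤ l) (ω : Bool × (K → Bool)) (c : K × Bool) :
    0 ≤ nullRow l ω c := by
  unfold nullRow
  split_ifs <;> positivity

theorem altRow_nonneg {l : ℝ} (hl : 0 ≤ l) (ω : Bool × (K → Bool)) (c : K × Bool) :
    0 ≤ altRow l ω c := by
  unfold altRow
  have := columnFactor_nonneg ω.2 c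
  split_ifs <;> positivity

theorem rowLaw_nullRow [DecidableEq K] (p l : ℝ) (κ : K × Bool → ℕ) :
    rowLaw (rowPrior p) (nullRow l) κ =
      p * ∏ c, poissonWeight (1 / Fintype.card (K × Bool)) (κ c) +
      (1 - p) * ∏ c, poissonWeight (l / Fintype.card (K × Bool)) (κ c) := by
  simp only [rowLaw, rowPrior, nullRow]
  rw [Fintype.sum_prod_type]
  simp only [Fintype.sum_bool, if_true, Bool.false_eq_true, if_false, sum_const, card_univ,
    nsmul_eq_mul, Fintype.card_fun, Fintype.card_bool]
  push_cast
  field_simp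

/-- A pattern preserves the total intensity of the row, so the exponential factors cancel and the
likelihood ratio is a monomial. -/
theorem prod_poissonWeight_columnFactor (x : ℝ) (r : K → Bool) (κ : K × Bool → ℕ) :
    ∏ c, poissonWeight (x * columnFactor r c) (κ c) =
      (∏ c, poissonWeight x (κ c)) * ∏ c, columnFactor r c ^ κ c := by
  have h : ∀ c, poissonWeight (x * columnFactor r c) (κ c) =
      Real.exp (-x * (columnFactor r c - 1)) * (poissonWeight x (κ c) * columnFactor r c ^ κ c) := by
    intro c
    have : Real.exp (-(x * columnFactor r c)) =
        Real.exp (-x * (columnFactor r c - 1)) * Real.exp (-x) := by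
      rw [← Real.exp_add]
      congr 1
      ring
    rw [poissonWeight, poissonWeight, mul_pow, this]
    ring
  simp only [h, prod_mul_distrib]
  rw [← Real.exp_sum, ← mul_sum, sum_columnFactor_sub_one]
  simp

theorem rowLaw_altRow [DecidableEq K] (p l : ℝ) (κ : K × Bool → ℕ) :
    rowLaw (rowPrior p) (altRow l) κ =
      p * ∏ c, poissonWeight (1 / Fintype.card (K × Bool)) (κ c) +
      (1 - p) * ((∏ c, poissonWeight (l / Fintype.card (K × Bool)) (κ c)) * meanRatio κ) := by
  simp only [rowLaw, rowPrior, altRow]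
  rw [Fintype.sum_prod_type]
  simp only [Fintype.sum_bool, if_true, Bool.false_eq_true, if_false, sum_const, card_univ,
    nsmul_eq_mul, Fintype.card_fun, Fintype.card_bool, prod_poissonWeight_columnFactor]
  rw [← mul_sum, ← mul_sum, meanRatio]
  push_cast
  field_simp

/-- Uniform rows of totals `l` and `1` have a likelihood ratio depending only on the total count,
which lets a light row be compared with a heavy one. -/
theorem prod_poissonWeight_scale {C : Type*} [Fintype C] [Nonempty C] (l : ℝ) (κ : C → ℕ) :
    ∏ c, poissonWeight (l / Fintype.card C) (κ c) =
      Real.exp (1 - l) * l ^ (∑ c, κ c) * ∏ c, poissonWeight (1 / Fintype.card C) (κ c) := by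
  have hm : (Fintype.card C : ℝ) ≠ 0 := by simp
  have h : ∀ c, poissonWeight (l / Fintype.card C) (κ c) =
      Real.exp ((1 - l) / Fintype.card C) * l ^ κ c * poissonWeight (1 / Fintype.card C) (κ c) := by
    intro c
    have : Real.exp (-(l / Fintype.card C)) =
        Real.exp ((1 - l) / Fintype.card C) * Real.exp (-(1 / Fintype.card C)) := by
      rw [← Real.exp_add]
      congr 1
      ring
    rw [poissonWeight, poissonWeight, this, div_pow, div_pow, one_pow]
    ring
  simp only [h, prod_mul_distrib]
  rw [← Real.exp_sum, prod_pow_eq_pow_sum, sum_const, card_univ, nsmul_eq_mul,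
    mul_div_cancel₀ _ hm]

theorem cosh_pow_card_le [Nonempty K] :
    Real.cosh (2 * (1 / Fintype.card (K × Bool))) ^ Fintype.card K ≤
      1 + 2 / Fintype.card (K × Bool) := by
  have hK : (1 : ℝ) ≤ Fintype.card K := by exact_mod_cast Fintype.card_pos
  rw [Fintype.card_prod, Fintype.card_bool]
  push_cast
  set t : ℝ := (Fintype.card K : ℝ)
  have h1 : Real.cosh (2 * (1 / (t * 2))) ^ Fintype.card K ≤ Real.exp (1 / (2 * t)) := by
    calc Real.cosh (2 * (1 / (t * 2))) ^ Fintype.card K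
        ≤ Real.exp ((2 * (1 / (t * 2))) ^ 2 / 2) ^ Fintype.card K := by
          gcongr
          exact Real.cosh_le_exp_half_sq _
      _ = Real.exp (1 / (2 * t)) := by
          rw [← Real.exp_nat_mul]
          congr 1
          change t * _ = _
          field_simp
  refine h1.trans ?_
  have h2 : 1 / (2 * t) ≤ 1 / 2 := by
    rw [div_le_div_iff₀ (by positivity) (by norm_num)]
    linarith
  have h3 : 0 ≤ 1 / (2 * t) := by positivity
  have e : 2 / (t * 2) = 2 * (1 / (2 * t)) := by field_simp
  rw [e]
  set y := 1 / (2 * t)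
  have h4 : (1 - y) * Real.exp y ≤ 1 := by
    have := Real.add_one_le_exp (-y)
    calc (1 - y) * Real.exp y ≤ Real.exp (-y) * Real.exp y := by gcongr; linarith
      _ = 1 := by rw [← Real.exp_add]; simp
  have h5 : 1 ≤ (1 - y) * (1 + 2 * y) := by nlinarith
  exact le_of_mul_le_mul_left (h4.trans h5) (by linarith)

/-- The chi-square bound for a single row. -/
theorem exists_row_chiSq_bound [DecidableEq K] [Nonempty K] {p l : ℝ} (hp : 0 < p) (hp1 : p ≤ 1) (hl : 0 ≤ l)
    (hl1 : l ≤ 1) :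
    ∃ (u : (K × Bool → ℕ) → ℝ) (S : ℝ), HasSum u S ∧
      S ≤ 1 + 18 * l ^ 4 / (p * Fintype.card (K × Bool)) ∧
      ∀ κ, rowLaw (rowPrior p) (altRow l) κ ^ 2 ≤ u κ * rowLaw (rowPrior p) (nullRow l) κ := by
  set m : ℝ := (Fintype.card (K × Bool) : ℝ) with hm
  have hmpos : 0 < m := by
    rw [hm, Nat.cast_pos]
    exact Fintype.card_pos
  let P : (K × Bool → ℕ) → ℝ := fun κ => ∏ c, poissonWeight (1 / m) (κ c)
  have hP : HasSum P 1 := by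
    simpa [P] using hasSum_prod_poissonWeight_mul_pow (C := K × Bool) (x := 1 / m) (by positivity)
      (y := fun _ => 1) (fun _ => zero_le_one)
  have hPpos : ∀ κ, 0 ≤ P κ := fun κ => prod_nonneg fun c _ => poissonWeight_nonneg (by positivity) _
  have hb1 : HasSum (fun κ => P κ * meanRatio κ) 1 := hasSum_mul_meanRatio (by positivity)
  have hb2 : HasSum (fun κ => P κ * meanRatio κ ^ 2)
      (Real.cosh (2 * (1 / m)) ^ Fintype.card K) := hasSum_mul_meanRatio_sq (by positivity)
  have hq0 := hasSum_rowLaw (sum_rowPrior (K := K) p) (nullRow_nonneg (K := K) hl)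
  have hq1 := hasSum_rowLaw (sum_rowPrior (K := K) p) (altRow_nonneg (K := K) hl)
  -- With null law `q0` and alternative law `q1`, `u` is a bound for `(q1 - q0) ^ 2 / q0`, plus `2 *
  -- q1 - q0`.
  have hu := ((((hb2.sub (hb1.mul_left 2)).add hP).mul_left (9 * l ^ 4 / p)).add
    (hq1.mul_left 2)).sub hq0
  refine ⟨_, _, hu, ?_, fun κ => ?_⟩
  · have h1 := cosh_pow_card_le (K := K)
    rw [← hm] at h1
    have h2 : 9 * l ^ 4 / p * (Real.cosh (2 * (1 / m)) ^ Fintype.card K - 2 * 1 + 1) ≤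
        9 * l ^ 4 / p * (2 / m) := by
      gcongr
      linarith
    have h3 : 9 * l ^ 4 / p * (2 / m) = 18 * l ^ 4 / (p * m) := by
      field_simp
      ring
    linarith
  · have e0 := rowLaw_nullRow (K := K) p l κ
    have e1 := rowLaw_altRow (K := K) p l κ
    rw [prod_poissonWeight_scale l κ] at e0 e1
    rw [← hm] at e0 e1
    change _ = p * P κ + _ * (_ * P κ) at e0
    change _ = p * P κ + _ * (_ * P κ * _) at e1
    set q0 := rowLaw (rowPrior p) (nullRow l) κ
    set q1 := rowLaw (rowPrior p) (altRow l) κ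
    set b := meanRatio κ with hb
    set w := Real.exp (1 - l) * l ^ (∑ c, κ c) with hw
    have hw0 : 0 ≤ w := by positivity
    have hp1' : 0 ≤ 1 - p := by linarith
    -- Masking: the heavy component alone bounds the null law from below.
    have hlow : p * P κ ≤ q0 := by
      rw [e0]
      have := mul_nonneg hp1' (mul_nonneg hw0 (hPpos κ))
      linarith
    have hwb : w ^ 2 * (b - 1) ^ 2 ≤ 9 * l ^ 4 * (b - 1) ^ 2 := by
      by_cases hκ : ∑ c, κ c ≤ 1
      · rw [hb, meanRatio_eq_one hκ]
        simp
      · have h1 : l ^ (∑ c, κ c) ≤ l ^ 2 := pow_le_pow_of_le_one hl hl1 (by omega)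
        have h2 : Real.exp (1 - l) ≤ 3 := by
          calc Real.exp (1 - l) ≤ Real.exp 1 := by gcongr; linarith
            _ ≤ 3 := by
              have := Real.exp_one_lt_d9
              linarith
        have h3 : w ≤ 3 * l ^ 2 := by
          rw [hw]
          gcongr
        have h4 : w ^ 2 ≤ 9 * l ^ 4 := by
          calc w ^ 2 ≤ (3 * l ^ 2) ^ 2 := by gcongr
            _ = _ := by ring
        gcongr
    have hdiff : (q1 - q0) ^ 2 ≤ 9 * l ^ 4 * (b - 1) ^ 2 * P κ ^ 2 := by
      have e : q1 - q0 = (1 - p) * (w * P κ * (b - 1)) := by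
        rw [e0, e1]
        ring
      rw [e, mul_pow]
      calc (1 - p) ^ 2 * (w * P κ * (b - 1)) ^ 2 ≤ 1 * (w * P κ * (b - 1)) ^ 2 := by
            gcongr
            exact pow_le_one₀ hp1' (by linarith)
        _ = (w ^ 2 * (b - 1) ^ 2) * P κ ^ 2 := by ring
        _ ≤ _ := by gcongr
    have hmain : (q1 - q0) ^ 2 ≤ 9 * l ^ 4 / p * (P κ * b ^ 2 - 2 * (P κ * b) + P κ) * q0 := by
      calc (q1 - q0) ^ 2 ≤ 9 * l ^ 4 * (b - 1) ^ 2 * P κ ^ 2 := hdiff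
        _ = 9 * l ^ 4 / p * (P κ * (b - 1) ^ 2) * (p * P κ) := by field_simp
        _ ≤ 9 * l ^ 4 / p * (P κ * (b - 1) ^ 2) * q0 := by
            have := hPpos κ
            gcongr
        _ = _ := by ring
    linarith [show q1 ^ 2 = (q1 - q0) ^ 2 + (2 * q1 - q0) * q0 by ring]

end pattern

/-! ### Restriction to fewer columns -/

section comap

variable {A C C' : Type*} [Fintype C] [Fintype C'] {e : C' → C}

theorem yesProb_extend {D D' : Type*} [Fintype D] [Fintype D'] {F : D' → D}
    (hF : Function.Injective F) {N : ℕ} (T : RandomizedTest D N) (P : D' → ℝ) :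
    yesProb (Function.extend F P 0) T = yesProb P (fun x => T (F ∘ x) : RandomizedTest D' N) := by
  classical
  symm
  refine Fintype.sum_of_injective (fun x : Fin N → D' => F ∘ x) hF.comp_left _ _ ?_ ?_
  · intro x hx
    obtain ⟨i, hi⟩ : ∃ i, ¬ ∃ d, F d = x i := by
      by_contra! h
      choose y hy using h
      exact hx ⟨y, funext hy⟩
    rw [prod_eq_zero (mem_univ i), zero_mul]
    rw [Function.extend_apply' _ _ _ hi]
    rfl
  · intro x
    simp [hF.extend_apply]

theorem sum_extend_prodMap (he : Function.Injective e) (P : A × C' → ℝ) (a : A) :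
    ∑ c, Function.extend (Prod.map (id : A → A) e) P 0 (a, c) = ∑ c', P (a, c') := by
  have hF : Function.Injective (Prod.map (id : A → A) e) := Function.injective_id.prodMap he
  symm
  refine Fintype.sum_of_injective e he _ _ ?_ ?_
  · intro c hc
    rw [Function.extend_apply']
    · rfl
    · rintro ⟨⟨a', c'⟩, h⟩
      exact hc ⟨c', (Prod.ext_iff.1 h).2⟩
  · intro c'
    exact (hF.extend_apply P 0 (a, c')).symm

/-- A tester restricts to any subset of the second alphabet. -/
theorem IsIndependenceTester.comap [Fintype A] (he : Function.Injective e) {N : ℕ} {ε : ℝ}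
    {T : RandomizedTest (A × C) N} (hT : IsIndependenceTester ε T) :
    IsIndependenceTester ε
      (fun x => T (Prod.map id e ∘ x) : RandomizedTest (A × C') N) := by
  intro P hP
  have hF : Function.Injective (Prod.map (id : A → A) e) := Function.injective_id.prodMap he
  set Q : A × C → ℝ := Function.extend (Prod.map (id : A → A) e) P 0 with hQ
  have hQF : ∀ a c', Q (a, e c') = P (a, c') := fun a c' => hF.extend_apply P 0 (a, c')
  have hQ0 : ∀ a c, c ∉ Set.range e → Q (a, c) = 0 := by
    intro a c hc
    rw [hQ, Function.extend_apply']
    · rfl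
    · rintro ⟨⟨a', c'⟩, h⟩
      exact hc ⟨c', (Prod.ext_iff.1 h).2⟩
  have hA : marginalA Q = marginalA P := funext fun a => sum_extend_prodMap he P a
  have hC : ∀ c', marginalC Q (e c') = marginalC P c' := fun c' =>
    sum_congr rfl fun a _ => hQF a c'
  have hC0 : ∀ c, c ∉ Set.range e → marginalC Q c = 0 := fun c hc =>
    sum_eq_zero fun a _ => hQ0 a c hc
  have hsimplex : Q ∈ stdSimplex ℝ (A × C) := by
    refine ⟨fun d => ?_, ?_⟩
    · obtain ⟨a, c⟩ := d
      by_cases hc : c ∈ Set.range e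
      · obtain ⟨c', rfl⟩ := hc
        rw [hQF]
        exact hP.1 _
      · rw [hQ0 a c hc]
    · rw [← hP.2, Fintype.sum_prod_type, Fintype.sum_prod_type]
      exact sum_congr rfl fun a _ => sum_extend_prodMap he P a
  have hH : hellingerSq Q (marginalProduct Q) = hellingerSq P (marginalProduct P) := by
    unfold hellingerSq
    rw [Fintype.sum_prod_type, Fintype.sum_prod_type]
    congr 1
    refine sum_congr rfl fun a _ => ?_
    symm
    refine Fintype.sum_of_injective e he _ _ ?_ ?_
    · intro c hc
      simp [marginalProduct, hQ0 a c hc, hC0 c hc]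
    · intro c'
      simp [marginalProduct, hQF, hA, hC]
  have := hT Q hsimplex
  rw [hH, hQ, yesProb_extend hF] at this
  exact this

end comap

/-! ### Acceptance probabilities, product distributions and averages over the prior -/

theorem yesProb_nonneg {D : Type*} [Fintype D] {N : ℕ} {P : D → ℝ} (hP : P ∈ stdSimplex ℝ D)
    (T : RandomizedTest D N) : 0 ≤ yesProb P T :=
  sum_nonneg fun x _ => mul_nonneg (prod_nonneg fun _ _ => hP.1 _) (T x).2.1

theorem yesProb_le_one {D : Type*} [Fintype D] {N : ℕ} {P : D → ℝ} (hP : P ∈ stdSimplex ℝ D)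
    (T : RandomizedTest D N) : yesProb P T ≤ 1 := by
  have h : ∑ x : Fin N → D, ∏ i, P (x i) = 1 := by
    rw [sum_pi_prod (fun _ : Fin N => P)]
    simp [hP.2]
  rw [← h]
  exact sum_le_sum fun x _ =>
    mul_le_of_le_one_right (prod_nonneg fun _ _ => hP.1 _) (T x).2.2

theorem div_sum_mem_stdSimplex {D : Type*} [Fintype D] {μ : D → ℝ} (hμ : ∀ d, 0 ≤ μ d)
    (hpos : 0 < ∑ d, μ d) : (fun d => μ d / ∑ e, μ e) ∈ stdSimplex ℝ D :=
  ⟨fun d => div_nonneg (hμ d) hpos.le, by rw [← sum_div, div_self hpos.ne']⟩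

theorem hellingerSq_marginalProduct_eq_zero {A C : Type*} [Fintype A] [Fintype C] {g : A → ℝ}
    (hg : (fun d : A × C => g d.1) ∈ stdSimplex ℝ (A × C)) :
    hellingerSq (fun d : A × C => g d.1) (marginalProduct fun d : A × C => g d.1) = 0 := by
  have h1 : (Fintype.card C : ℝ) * ∑ a, g a = 1 := by
    have := hg.2
    rw [Fintype.sum_prod_type] at this
    simpa [← mul_sum] using this
  have h2 : (marginalProduct fun d : A × C => g d.1) = fun d => g d.1 := by
    ext d
    simp only [marginalProduct, marginalA, marginalC, sum_const, card_univ, nsmul_eq_mul]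
    linear_combination g d.1 * h1
  rw [h2]
  simp [hellingerSq]

theorem sum_pi_prod_mul_apply {ι Ω : Type*} [Fintype ι] [Fintype Ω] [DecidableEq ι] {π : Ω → ℝ}
    (hπ : ∑ o, π o = 1) (f : Ω → ℝ) (j : ι) :
    ∑ ω : ι → Ω, (∏ i, π (ω i)) * f (ω j) = ∑ o, π o * f o := by
  have h : ∀ ω : ι → Ω, (∏ i, π (ω i)) * f (ω j) =
      ∏ i, (π (ω i) * if i = j then f (ω i) else 1) := by
    intro ω
    rw [prod_mul_distrib]
    simp
  simp only [h]
  rw [sum_pi_prod (fun i o => π o * if i = j then f o else 1), prod_eq_single j]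
  · simp
  · intro i _ hij
    simp [hij, hπ]
  · simp

/-- The number of rows that are marked as heavy. -/
noncomputable def heavyCount {A K : Type*} [Fintype A] (ω : A → Bool × (K → Bool)) : ℝ := ∑ a, if (ω a).1 then 1 else 0

theorem heavyCount_nonneg {A K : Type*} [Fintype A] (ω : A → Bool × (K → Bool)) : 0 ≤ heavyCount ω :=
  sum_nonneg fun a _ => by split_ifs <;> norm_num

/-! ### Intensity matrices and their distance from independence -/

section intensity

variable {A K : Type*} [DecidableEq A]

/-- The intensities under the null hypothesis, with a row `a₀` of total intensity `R`. -/
noncomputable def nullIntensity [Fintype K] (a₀ : A) (R l : ℝ) (a : A) (ω : Bool × (K → Bool))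
    (c : K × Bool) : ℝ :=
  if a = a₀ then R / Fintype.card (K × Bool) else nullRow l ω c

/-- The intensities under the alternative, with a row `a₀` of total intensity `R`. -/
noncomputable def altIntensity [Fintype K] (a₀ : A) (R l : ℝ) (a : A) (ω : Bool × (K → Bool))
    (c : K × Bool) : ℝ :=
  if a = a₀ then R / Fintype.card (K × Bool) else altRow l ω c

variable [Fintype K] {a₀ : A} {R l : ℝ}

theorem nullIntensity_nonneg (hR : 0 ≤ R) (hl : 0 ≤ l) (a : A) (ω : Bool × (K → Bool))
    (c : K × Bool) : 0 ≤ nullIntensity a₀ R l a ω c := by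
  unfold nullIntensity
  split_ifs
  · positivity
  · exact nullRow_nonneg hl ω c

theorem altIntensity_nonneg (hR : 0 ≤ R) (hl : 0 ≤ l) (a : A) (ω : Bool × (K → Bool))
    (c : K × Bool) : 0 ≤ altIntensity a₀ R l a ω c := by
  unfold altIntensity
  split_ifs
  · positivity
  · exact altRow_nonneg hl ω c

variable [Nonempty K]

theorem sum_nullIntensity (a : A) (ω : Bool × (K → Bool)) :
    ∑ c, nullIntensity a₀ R l a ω c = if a = a₀ then R else if ω.1 then 1 else l := by
  have hm : (Fintype.card (K × Bool) : ℝ) ≠ 0 := by simp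
  simp only [nullIntensity, nullRow]
  split_ifs <;> rw [sum_const, card_univ, nsmul_eq_mul, mul_div_cancel₀ _ hm]

theorem sum_altIntensity (a : A) (ω : Bool × (K → Bool)) :
    ∑ c, altIntensity a₀ R l a ω c = if a = a₀ then R else if ω.1 then 1 else l := by
  have hm : (Fintype.card (K × Bool) : ℝ) ≠ 0 := by simp
  simp only [altIntensity, altRow]
  split_ifs
  · rw [sum_const, card_univ, nsmul_eq_mul, mul_div_cancel₀ _ hm]
  · rw [sum_const, card_univ, nsmul_eq_mul, mul_div_cancel₀ _ hm]
  · rw [← mul_sum, sum_columnFactor, div_mul_cancel₀ _ hm]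

variable [Fintype A]

theorem le_sum_nullIntensity (hl : 0 ≤ l) (ω : A → Bool × (K → Bool)) :
    R ≤ ∑ d : A × (K × Bool), nullIntensity a₀ R l d.1 (ω d.1) d.2 := by
  rw [Fintype.sum_prod_type]
  simp only [sum_nullIntensity]
  rw [← add_sum_erase univ _ (mem_univ a₀), if_pos rfl]
  refine le_add_of_nonneg_right (sum_nonneg fun a ha => ?_)
  rw [if_neg (ne_of_mem_erase ha)]
  split_ifs <;> positivity

theorem le_sum_altIntensity (hl : 0 ≤ l) (ω : A → Bool × (K → Bool)) :
    R ≤ ∑ d : A × (K × Bool), altIntensity a₀ R l d.1 (ω d.1) d.2 := by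
  refine (le_sum_nullIntensity (a₀ := a₀) hl ω).trans_eq ?_
  rw [Fintype.sum_prod_type, Fintype.sum_prod_type]
  simp only [sum_nullIntensity, sum_altIntensity]

theorem sum_altIntensity_le (hl : 0 ≤ l) (ω : A → Bool × (K → Bool)) :
    ∑ d : A × (K × Bool), altIntensity a₀ R l d.1 (ω d.1) d.2 ≤
      R + heavyCount ω + Fintype.card A * l := by
  rw [Fintype.sum_prod_type]
  simp only [sum_altIntensity]
  rw [← add_sum_erase univ _ (mem_univ a₀), if_pos rfl, add_assoc]
  gcongr
  calc ∑ a ∈ univ.erase a₀, (if a = a₀ then R else if (ω a).1 then 1 else l)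
      ≤ ∑ a ∈ univ.erase a₀, ((if (ω a).1 then 1 else 0) + l) := by
        refine sum_le_sum fun a ha => ?_
        rw [if_neg (ne_of_mem_erase ha)]
        split_ifs <;> linarith
    _ ≤ ∑ a, ((if (ω a).1 then 1 else 0) + l) := by
        refine sum_le_sum_of_subset_of_nonneg (subset_univ _) fun a _ _ => ?_
        split_ifs <;> positivity
    _ = heavyCount ω + Fintype.card A * l := by
        rw [sum_add_distrib, sum_const, card_univ, nsmul_eq_mul]
        rfl

/-- The alternatives are far from independent. -/
theorem le_hellingerSq_altIntensity {ε : ℝ} (hA : 2 ≤ Fintype.card A) (hR : 0 < R) (hε : 0 ≤ ε)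
    (hl : l = 64 * R * ε / Fintype.card A) (hε1 : 64 * ε ≤ 1 / 2) (ω : A → Bool × (K → Bool))
    (h1 : heavyCount ω ≤ R / 4) (h2 : heavyCount ω ≤ Fintype.card A / 4) :
    ε ≤ hellingerSq (fun d : A × (K × Bool) => altIntensity a₀ R l d.1 (ω d.1) d.2 /
        ∑ e : A × (K × Bool), altIntensity a₀ R l e.1 (ω e.1) e.2)
      (marginalProduct fun d : A × (K × Bool) => altIntensity a₀ R l d.1 (ω d.1) d.2 /
        ∑ e : A × (K × Bool), altIntensity a₀ R l e.1 (ω e.1) e.2) := by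
  set n : ℝ := (Fintype.card A : ℝ) with hn
  have hn2 : 2 ≤ n := by
    rw [hn]
    exact_mod_cast hA
  have hl0 : 0 ≤ l := by
    rw [hl]
    positivity
  have hnl : n * l = 64 * R * ε := by
    rw [hl]
    field_simp
  set Z := ∑ e : A × (K × Bool), altIntensity a₀ R l e.1 (ω e.1) e.2 with hZ
  have hZR : R ≤ Z := le_sum_altIntensity hl0 ω
  -- The summands are at most `R`, `R / 4` and `n * l = 64 * R * ε ≤ R / 2`.
  have hZ2 : Z ≤ 2 * R := by
    have : Z ≤ R + heavyCount ω + n * l := sum_altIntensity_le hl0 ω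
    nlinarith
  have hZ0 : 0 < Z := hR.trans_le hZR
  set m : ℝ := (Fintype.card (K × Bool) : ℝ) with hm
  have hm0 : 0 < m := by
    rw [hm, Nat.cast_pos]
    exact Fintype.card_pos
  set P : A × (K × Bool) → ℝ := fun d => altIntensity a₀ R l d.1 (ω d.1) d.2 / Z with hP
  have hP0 : ∀ d, 0 ≤ P d := fun d => div_nonneg (altIntensity_nonneg hR.le hl0 _ _ _) hZ0.le
  have hPC : ∀ c, R / m / Z ≤ marginalC P c := by
    intro c
    refine le_trans (le_of_eq ?_) (single_le_sum (fun a _ => hP0 (a, c)) (mem_univ a₀))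
    simp [hP, altIntensity, hm]
  -- In a light row the cells of half the columns are empty, and each contributes its whole product
  -- mass; `1 - columnFactor / 2` indicates these cells. For `a₀` and the heavy rows the left side
  -- is nonpositive.
  have hrow : ∀ a, l * R / (2 * Z ^ 2) * (1 - (if a = a₀ then 1 else 0) -
      (if (ω a).1 then 1 else 0)) ≤ ∑ c, (√(P (a, c)) - √(marginalProduct P (a, c))) ^ 2 := by
    intro a
    have hB : 0 ≤ l * R / (2 * Z ^ 2) := by positivity
    have hnn : 0 ≤ ∑ c, (√(P (a, c)) - √(marginalProduct P (a, c))) ^ 2 :=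
      sum_nonneg fun c _ => sq_nonneg _
    by_cases ha : a = a₀
    · refine le_trans (mul_nonpos_of_nonneg_of_nonpos hB ?_) hnn
      rw [if_pos ha]
      split_ifs <;> norm_num
    by_cases hω : (ω a).1 = true
    · refine le_trans (mul_nonpos_of_nonneg_of_nonpos hB ?_) hnn
      simp [ha, hω]
    have hPA : marginalA P a = l / Z := by
      simp only [marginalA, hP]
      rw [← sum_div, sum_altIntensity, if_neg ha, if_neg hω]
    calc l * R / (2 * Z ^ 2) * (1 - (if a = a₀ then 1 else 0) - (if (ω a).1 then 1 else 0))
        = ∑ c, l / Z * (R / m / Z) * (1 - columnFactor (ω a).2 c / 2) := by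
          rw [← mul_sum, sum_sub_distrib, ← sum_div, sum_columnFactor]
          simp only [ha, hω, if_false, sum_const, card_univ, nsmul_eq_mul, ← hm]
          field_simp
          norm_num
      _ ≤ _ := by
          refine sum_le_sum fun c _ => ?_
          by_cases hc : (ω a).2 c.1 = c.2
          · simp only [columnFactor, if_pos hc]
            norm_num
            positivity
          · have hPz : P (a, c) = 0 := by simp [hP, altIntensity, ha, altRow, hω, columnFactor, hc]
            have hprod : l / Z * (R / m / Z) ≤ marginalProduct P (a, c) := by
              rw [marginalProduct, hPA]
              exact mul_le_mul_of_nonneg_left (hPC c) (by positivity)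
            have h0 : 0 ≤ marginalProduct P (a, c) := le_trans (by positivity) hprod
            rw [hPz, Real.sqrt_zero, zero_sub, neg_sq, Real.sq_sqrt h0]
            simpa [columnFactor, hc] using hprod
  have hsum : l * R / (2 * Z ^ 2) * (n - 1 - heavyCount ω) ≤
      ∑ d, (√(P d) - √(marginalProduct P d)) ^ 2 := by
    rw [Fintype.sum_prod_type]
    refine le_trans (le_of_eq ?_) (sum_le_sum fun a _ => hrow a)
    rw [← mul_sum, sum_sub_distrib, sum_sub_distrib]
    simp [heavyCount, hn]
  have hlow : 2 * ε ≤ l * R / (2 * Z ^ 2) * (n - 1 - heavyCount ω) := by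
    have hc : n / 4 ≤ n - 1 - heavyCount ω := by linarith
    -- The constant `64` in `l` is chosen to make this an equality.
    calc 2 * ε = l * R / (2 * (2 * R) ^ 2) * (n / 4) := by
          have : l * n = 64 * R * ε := by rw [← hnl]; ring
          field_simp
          linear_combination (-1) * this
      _ ≤ _ := by gcongr
  unfold hellingerSq
  linarith

end intensity

/-! ### Comparison of the two families -/

section lowerBound

variable {A K : Type*} [DecidableEq A] [DecidableEq K] [Fintype A] [Fintype K]
  {N : ℕ} {ε R : ℝ}

theorem sum_prior_mul_heavyCount (p : ℝ) :
    ∑ ω : A → Bool × (K → Bool), (∏ a, rowPrior p (ω a)) * heavyCount ω =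
      Fintype.card A * p := by
  have h : ∀ a : A, ∑ ω : A → Bool × (K → Bool), (∏ a, rowPrior p (ω a)) *
      (if (ω a).1 then (1 : ℝ) else 0) = p := by
    intro a
    rw [sum_pi_prod_mul_apply (sum_rowPrior p) (fun o => if o.1 then (1 : ℝ) else 0) a,
      Fintype.sum_prod_type]
    simp [rowPrior]
    field_simp
  simp only [heavyCount, mul_sum]
  rw [sum_comm]
  simp only [h, sum_const, card_univ, nsmul_eq_mul]

theorem poissonWeight_pos {x : ℝ} (hx : 0 < x) (n : ℕ) : 0 < poissonWeight x n := by
  unfold poissonWeight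
  positivity

theorem rowLaw_nullRow_pos [Nonempty K] {p l : ℝ} (hp : 0 < p) (hp1 : p ≤ 1) (hl : 0 ≤ l)
    (κ : K × Bool → ℕ) : 0 < rowLaw (rowPrior p) (nullRow l) κ := by
  have hm0 : (0 : ℝ) < Fintype.card (K × Bool) := by
    rw [Nat.cast_pos]
    exact Fintype.card_pos
  rw [rowLaw_nullRow]
  have h1 : 0 < ∏ c, poissonWeight (1 / Fintype.card (K × Bool)) (κ c) :=
    prod_pos fun c _ => poissonWeight_pos (by positivity) _
  have h2 : 0 ≤ ∏ c, poissonWeight (l / Fintype.card (K × Bool)) (κ c) :=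
    prod_nonneg fun c _ => poissonWeight_nonneg (by positivity) _
  have h3 : 0 ≤ 1 - p := by linarith
  positivity

variable [Nonempty K]

theorem two_thirds_mul_le_mixtureAccept_null {T : RandomizedTest (A × (K × Bool)) N}
    (hT : IsIndependenceTester ε T) (a₀ : A) {p l : ℝ} (hp : 0 ≤ p) (hp1 : p ≤ 1) (hl : 0 ≤ l)
    (hR : 2 * (N : ℝ) + 10 ≤ R) :
    2 / 3 * (29 / 30) ≤ mixtureAccept T (rowPrior p) (nullIntensity a₀ R l) := by
  have hR0 : 0 < R := lt_of_lt_of_le (by positivity) hR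
  have hone : ∑ ω : A → Bool × (K → Bool), ∏ a, rowPrior p (ω a) = 1 := by
    rw [sum_pi_prod (fun _ : A => rowPrior p)]
    simp [sum_rowPrior]
  rw [← one_mul (2 / 3 * (29 / 30) : ℝ), ← hone, sum_mul]
  refine sum_le_sum fun ω _ => ?_
  refine mul_le_mul_of_nonneg_left ?_ (prod_nonneg fun a _ => rowPrior_nonneg hp hp1 _)
  have hZ := le_sum_nullIntensity (a₀ := a₀) (R := R) hl ω
  have hmem := div_sum_mem_stdSimplex
    (μ := fun d : A × (K × Bool) => nullIntensity a₀ R l d.1 (ω d.1) d.2)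
    (fun d => nullIntensity_nonneg hR0.le hl _ _ _) (hR0.trans_le hZ)
  have htail := sum_poissonWeight_lt_le (hR0.le.trans hZ) (hR.trans hZ)
  have hyes := (hT _ hmem).1 ?_
  · exact mul_le_mul hyes (by linarith) (by norm_num) (yesProb_nonneg hmem T)
  · set Z := ∑ e : A × (K × Bool), nullIntensity a₀ R l e.1 (ω e.1) e.2
    let c₀ : K × Bool := (Classical.arbitrary K, true)
    exact hellingerSq_marginalProduct_eq_zero (C := K × Bool)
      (g := fun a => nullIntensity a₀ R l a (ω a) c₀ / Z) hmem

/-- Markov's inequality: the mean number of heavy marks is `p * n`. Up to `100 * (p * n)` marks,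
which is at most `R / 4` and `n / 4`, the tester must reject; more marks have probability at most `1
/ 100`. -/
theorem mixtureAccept_alt_le {T : RandomizedTest (A × (K × Bool)) N}
    (hT : IsIndependenceTester ε T) (a₀ : A) {p l : ℝ} (hp : 0 < p) (hp1 : p ≤ 1)
    (hR : 2 * (N : ℝ) + 10 ≤ R) (hA : 2 ≤ Fintype.card A) (hε : 0 ≤ ε)
    (hε1 : 64 * ε ≤ 1 / 2) (hl : l = 64 * R * ε / Fintype.card A)
    (hpR : 400 * (p * Fintype.card A) ≤ R) (hpA : 400 * p ≤ 1) :
    mixtureAccept T (rowPrior p) (altIntensity a₀ R l) ≤ 1 / 3 + 1 / 100 := by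
  have hR0 : 0 < R := lt_of_lt_of_le (by positivity) hR
  set n : ℝ := (Fintype.card A : ℝ) with hn
  have hn2 : 2 ≤ n := by
    rw [hn]
    exact_mod_cast hA
  have hl0 : 0 ≤ l := by
    rw [hl]
    positivity
  have hone : ∑ ω : A → Bool × (K → Bool), ∏ a, rowPrior p (ω a) = 1 := by
    rw [sum_pi_prod (fun _ : A => rowPrior p)]
    simp [sum_rowPrior]
  have hpt : ∀ ω : A → Bool × (K → Bool),
      yesProb (fun d : A × (K × Bool) => altIntensity a₀ R l d.1 (ω d.1) d.2 /
        ∑ e : A × (K × Bool), altIntensity a₀ R l e.1 (ω e.1) e.2) T *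
        (1 - ∑ M ∈ range N, poissonWeight
          (∑ d : A × (K × Bool), altIntensity a₀ R l d.1 (ω d.1) d.2) M) ≤
      1 / 3 + heavyCount ω * (1 / (100 * (p * n))) := by
    intro ω
    have hZ := le_sum_altIntensity (a₀ := a₀) (R := R) hl0 ω
    have hmem := div_sum_mem_stdSimplex
      (μ := fun d : A × (K × Bool) => altIntensity a₀ R l d.1 (ω d.1) d.2)
      (fun d => altIntensity_nonneg hR0.le hl0 _ _ _) (hR0.trans_le hZ)
    have htail : 0 ≤ ∑ M ∈ range N, poissonWeight
        (∑ d : A × (K × Bool), altIntensity a₀ R l d.1 (ω d.1) d.2) M :=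
      sum_nonneg fun M _ => poissonWeight_nonneg (hR0.le.trans hZ) M
    refine (mul_le_of_le_one_right (yesProb_nonneg hmem T) (by linarith)).trans ?_
    have hH := heavyCount_nonneg ω
    by_cases hgood : heavyCount ω ≤ 100 * (p * n)
    · have hno := (hT _ hmem).2 (le_hellingerSq_altIntensity hA hR0 hε hl hε1 ω (by linarith)
        (by nlinarith))
      have : 0 ≤ heavyCount ω * (1 / (100 * (p * n))) := by positivity
      linarith
    · have h1 := yesProb_le_one hmem T
      have h2 : 1 ≤ heavyCount ω * (1 / (100 * (p * n))) := by
        rw [mul_one_div, le_div_iff₀ (by positivity)]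
        linarith
      linarith
  calc mixtureAccept T (rowPrior p) (altIntensity a₀ R l)
      ≤ ∑ ω : A → Bool × (K → Bool), (∏ a, rowPrior p (ω a)) *
          (1 / 3 + heavyCount ω * (1 / (100 * (p * n)))) :=
        sum_le_sum fun ω _ => mul_le_mul_of_nonneg_left (hpt ω)
          (prod_nonneg fun a _ => rowPrior_nonneg hp.le hp1 _)
    _ = 1 / 3 + 1 / 100 := by
        simp only [mul_add, sum_add_distrib, ← sum_mul, ← mul_assoc]
        rw [hone, sum_prior_mul_heavyCount, ← hn]
        field_simp

/-- The row `a₀` has the same law in both families and contributes a factor `1`; the others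
contribute at most `exp χ` each. -/
theorem mixtureAccept_null_sub_alt_le (T : RandomizedTest (A × (K × Bool)) N) (a₀ : A) {p l : ℝ}
    (hp : 0 < p) (hp1 : p ≤ 1) (hR : 0 < R) (hl : 0 ≤ l) (hl1 : l ≤ 1)
    (hchi : Fintype.card A * (18 * l ^ 4 / (p * Fintype.card (K × Bool))) ≤ 1 / 26) :
    mixtureAccept T (rowPrior p) (nullIntensity a₀ R l) -
      mixtureAccept T (rowPrior p) (altIntensity a₀ R l) ≤ 1 / 5 := by
  obtain ⟨u, S, hu, hS, hbound⟩ := exists_row_chiSq_bound (K := K) hp hp1 hl hl1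
  set χ : ℝ := 18 * l ^ 4 / (p * Fintype.card (K × Bool)) with hχ
  have hχ0 : 0 ≤ χ := by positivity
  have hm0 : (0 : ℝ) < Fintype.card (K × Bool) := by
    rw [Nat.cast_pos]
    exact Fintype.card_pos
  have hq : ∀ a κ, 0 < rowLaw (rowPrior p) (nullIntensity (K := K) a₀ R l a) κ := by
    intro a κ
    by_cases ha : a = a₀
    · simp only [rowLaw, nullIntensity, if_pos ha]
      rw [← sum_mul, sum_rowPrior, one_mul]
      exact prod_pos fun c _ => poissonWeight_pos (by positivity) _
    · have e : nullIntensity (K := K) a₀ R l a = nullRow l := by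
        ext ω c
        simp [nullIntensity, ha]
      rw [e]
      exact rowLaw_nullRow_pos hp hp1 hl κ
  refine mixtureAccept_sub_le T (sum_rowPrior p) (rowPrior_nonneg hp.le hp1)
    (fun a ω c => nullIntensity_nonneg hR.le hl a ω c)
    (fun a ω c => altIntensity_nonneg hR.le hl a ω c)
    (fun ω => hR.trans_le (le_sum_nullIntensity hl ω))
    (fun ω => hR.trans_le (le_sum_altIntensity hl ω)) hq
    (u := fun a => if a = a₀ then rowLaw (rowPrior p) (nullIntensity a₀ R l a) else u)
    (S := fun a => if a = a₀ then 1 else S) ?_ ?_ ?_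
  · intro a κ
    by_cases ha : a = a₀
    · have e : altIntensity (K := K) a₀ R l a = nullIntensity a₀ R l a := by
        ext ω c
        simp [nullIntensity, altIntensity, ha]
      rw [if_pos ha, e, sq]
    · have e : nullIntensity (K := K) a₀ R l a = nullRow l := by
        ext ω c
        simp [nullIntensity, ha]
      have e' : altIntensity (K := K) a₀ R l a = altRow l := by
        ext ω c
        simp [altIntensity, ha]
      rw [if_neg ha, e, e']
      exact hbound κ
  · intro a
    by_cases ha : a = a₀
    · simp only [if_pos ha]
      exact hasSum_rowLaw (sum_rowPrior p) fun ω c => nullIntensity_nonneg hR.le hl a ω c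
    · simpa only [if_neg ha] using hu
  · have hS0 : 0 ≤ S := by
      refine hu.nonneg fun κ => ?_
      exact nonneg_of_mul_nonneg_left ((sq_nonneg _).trans (hbound κ))
        (rowLaw_nullRow_pos hp hp1 hl κ)
    calc ∏ a : A, (if a = a₀ then 1 else S) ≤ ∏ _a : A, Real.exp χ := by
          refine prod_le_prod (fun a _ => ?_) fun a _ => ?_
          · split_ifs
            · exact zero_le_one
            · exact hS0
          · split_ifs
            · exact Real.one_le_exp hχ0
            · linarith [Real.add_one_le_exp χ]
      _ = Real.exp (Fintype.card A * χ) := by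
          rw [prod_const, card_univ, Real.exp_nat_mul]
      _ ≤ Real.exp (1 / 26) := by gcongr
      _ ≤ 1 + 1 / 25 := by
          have h := Real.add_one_le_exp (-(1 / 26) : ℝ)
          have h' : Real.exp (-(1 / 26)) * Real.exp (1 / 26) = 1 := by
            rw [← Real.exp_add]
            simp
          nlinarith [Real.exp_pos (1 / 26)]

/-- There is no tester whose number of samples is too small in terms of the rate `R`. -/
theorem not_isIndependenceTester (T : RandomizedTest (A × (K × Bool)) N)
    (hR : 2 * (N : ℝ) + 10 ≤ R) (hA : 2 ≤ Fintype.card A) (hε : 0 ≤ ε)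
    (hε1 : 64 * ε ≤ 1 / 2) (hRε : 64 * R * ε ≤ Fintype.card A)
    (h3 : (26 * 400 * 18 * 64 ^ 4) * (R ^ 3 * ε ^ 4) ≤
      (Fintype.card A : ℝ) ^ 2 * Fintype.card (K × Bool))
    (h4 : (26 * 400 * 18 * 64 ^ 4) * (R ^ 4 * ε ^ 4) ≤
      (Fintype.card A : ℝ) ^ 3 * Fintype.card (K × Bool)) :
    ¬ IsIndependenceTester ε T := by
  intro hT
  have hR0 : 0 < R := lt_of_lt_of_le (by positivity) hR
  have hcard : 0 < Fintype.card A := by omega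
  obtain ⟨a₀⟩ : Nonempty A := Fintype.card_pos_iff.1 hcard
  have hm0 : (0 : ℝ) < Fintype.card (K × Bool) := by
    rw [Nat.cast_pos]
    exact Fintype.card_pos
  set n : ℝ := (Fintype.card A : ℝ) with hn
  set m : ℝ := (Fintype.card (K × Bool) : ℝ) with hm
  have hn0 : 0 < n := by
    rw [hn]
    exact_mod_cast hcard
  set l := 64 * R * ε / n with hl
  have hl0 : 0 ≤ l := by positivity
  have hl1 : l ≤ 1 := (div_le_one hn0).2 hRε
  obtain ⟨p, hp, hpR, hpA, hchi⟩ : ∃ p : ℝ, 0 < p ∧ 400 * (p * n) ≤ R ∧ 400 * p ≤ 1 ∧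
      n * (18 * l ^ 4 / (p * m)) ≤ 1 / 26 := by
    -- The best choice is the largest admissible `p`, namely `min (R / n) 1 / 400`. The two cases
    -- use `h3` and `h4` respectively.
    by_cases hRn : R ≤ n
    · refine ⟨R / (400 * n), by positivity, le_of_eq (by field_simp), ?_, ?_⟩
      · rw [← mul_div_assoc, div_le_one (by positivity)]
        linarith
      · have e : n * (18 * l ^ 4 / (R / (400 * n) * m)) =
            (400 * 18 * 64 ^ 4) * (R ^ 3 * ε ^ 4) / (n ^ 2 * m) := by
          rw [hl]
          field_simp
        rw [e, div_le_iff₀ (by positivity)]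
        linarith
    · refine ⟨1 / 400, by positivity, by linarith, by norm_num, ?_⟩
      have e : n * (18 * l ^ 4 / (1 / 400 * m)) =
          (400 * 18 * 64 ^ 4) * (R ^ 4 * ε ^ 4) / (n ^ 3 * m) := by
        rw [hl]
        field_simp
      rw [e, div_le_iff₀ (by positivity)]
      linarith
  have hp1 : p ≤ 1 := by linarith
  have b0 := two_thirds_mul_le_mixtureAccept_null hT a₀ hp.le hp1 hl0 hR
  have b1 := mixtureAccept_alt_le hT a₀ hp hp1 hR hA hε hε1 hl hpR hpA
  have b2 := mixtureAccept_null_sub_alt_le T a₀ hp hp1 hR0 hl0 hl1 hchi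
  -- The gap `29 / 45 - (1 / 3 + 1 / 100)` exceeds `1 / 5`.
  linarith

end lowerBound

/-! ### Rates and constants -/

theorem div_pow_four_mul_pow_four {x y ε : ℝ} (hx : 0 ≤ x) (hy : 0 ≤ y) (hε : 0 < ε) :
    (x ^ (3 / 4 : ℝ) * y ^ (1 / 4 : ℝ) / ε) ^ 4 * ε ^ 4 = x ^ 3 * y := by
  have hx' : (x ^ (3 / 4 : ℝ)) ^ 4 = x ^ 3 := by
    rw [← Real.rpow_natCast (x ^ (3 / 4 : ℝ)), ← Real.rpow_mul hx, ← Real.rpow_natCast x]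
    norm_num
  have hy' : (y ^ (1 / 4 : ℝ)) ^ 4 = y := by
    rw [← Real.rpow_natCast (y ^ (1 / 4 : ℝ)), ← Real.rpow_mul hy]
    norm_num
  rw [div_pow, mul_pow, hx', hy', div_mul_cancel₀ _ (by positivity)]

theorem div_pow_three_mul_pow_four {x y ε : ℝ} (hx : 0 ≤ x) (hy : 0 ≤ y) (hε : 0 < ε) :
    (x ^ (2 / 3 : ℝ) * y ^ (1 / 3 : ℝ) / ε ^ (4 / 3 : ℝ)) ^ 3 * ε ^ 4 = x ^ 2 * y := by
  have hx' : (x ^ (2 / 3 : ℝ)) ^ 3 = x ^ 2 := by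
    rw [← Real.rpow_natCast (x ^ (2 / 3 : ℝ)), ← Real.rpow_mul hx, ← Real.rpow_natCast x]
    norm_num
  have hy' : (y ^ (1 / 3 : ℝ)) ^ 3 = y := by
    rw [← Real.rpow_natCast (y ^ (1 / 3 : ℝ)), ← Real.rpow_mul hy]
    norm_num
  have hε' : (ε ^ (4 / 3 : ℝ)) ^ 3 = ε ^ 4 := by
    rw [← Real.rpow_natCast (ε ^ (4 / 3 : ℝ)), ← Real.rpow_mul hε.le, ← Real.rpow_natCast ε]
    norm_num
  rw [div_pow, mul_pow, hx', hy', hε', div_mul_cancel₀ _ (by positivity)]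

theorem le_samples_of_isIndependenceTester {dA dC N : ℕ} {ε : ℝ} (hC : 2 ≤ dC) (hCA : dC ≤ dA)
    (hε : 0 < ε) (hε1 : ε ≤ 1 / 2000000) {T : RandomizedTest (Fin dA × Fin dC) N}
    (hT : IsIndependenceTester ε T) :
    1 / 400000 * min ((dA : ℝ) ^ (3 / 4 : ℝ) * (dC : ℝ) ^ (1 / 4 : ℝ) / ε)
      ((dA : ℝ) ^ (2 / 3 : ℝ) * (dC : ℝ) ^ (1 / 3 : ℝ) / ε ^ (4 / 3 : ℝ)) ≤ N := by
  by_contra! hN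
  set B₁ := (dA : ℝ) ^ (3 / 4 : ℝ) * (dC : ℝ) ^ (1 / 4 : ℝ) / ε with hB₁
  set B₂ := (dA : ℝ) ^ (2 / 3 : ℝ) * (dC : ℝ) ^ (1 / 3 : ℝ) / ε ^ (4 / 3 : ℝ) with hB₂
  set B := min B₁ B₂ with hB
  have hC1 : (1 : ℝ) ≤ dC := by exact_mod_cast (by omega : 1 ≤ dC)
  have hA1 : (1 : ℝ) ≤ dA := by exact_mod_cast (by omega : 1 ≤ dA)
  have hCA' : (dC : ℝ) ≤ dA := by exact_mod_cast hCA
  have hlow : 1 / ε ≤ B := by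
    have hεp : ε ^ (4 / 3 : ℝ) ≤ ε := by
      calc ε ^ (4 / 3 : ℝ) ≤ ε ^ (1 : ℝ) :=
            Real.rpow_le_rpow_of_exponent_ge hε (by linarith) (by norm_num)
        _ = ε := Real.rpow_one ε
    refine le_min ?_ ?_
    · rw [hB₁]
      gcongr
      exact one_le_mul_of_one_le_of_one_le (Real.one_le_rpow hA1 (by norm_num))
        (Real.one_le_rpow hC1 (by norm_num))
    · rw [hB₂]
      have : 1 ≤ (dA : ℝ) ^ (2 / 3 : ℝ) * (dC : ℝ) ^ (1 / 3 : ℝ) :=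
        one_le_mul_of_one_le_of_one_le (Real.one_le_rpow hA1 (by norm_num))
          (Real.one_le_rpow hC1 (by norm_num))
      gcongr
  -- This absorbs the additive `10`: `2 * N + 10 ≤ B / 200000 + 10 ≤ B / 100000`.
  have hB2M : 2000000 ≤ B := by
    refine le_trans ?_ hlow
    rw [le_div_iff₀ hε]
    linarith
  have hB4 : B ^ 4 * ε ^ 4 ≤ (dA : ℝ) ^ 3 * dC := by
    rw [← div_pow_four_mul_pow_four (by positivity) (by positivity) hε]
    gcongr
    exact min_le_left _ _
  have hB3 : B ^ 3 * ε ^ 4 ≤ (dA : ℝ) ^ 2 * dC := by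
    rw [← div_pow_three_mul_pow_four (by positivity) (by positivity) hε]
    gcongr
    exact min_le_right _ _
  have hBε : B * ε ≤ dA := by
    refine le_of_pow_le_pow_left₀ (n := 4) (by norm_num) (by positivity) ?_
    calc (B * ε) ^ 4 = B ^ 4 * ε ^ 4 := mul_pow _ _ _
      _ ≤ (dA : ℝ) ^ 3 * dC := hB4
      _ ≤ (dA : ℝ) ^ 3 * dA := by gcongr
      _ = (dA : ℝ) ^ 4 := by ring
  -- Columns come in pairs, so an odd `dC` loses one column; at least half of them remain.
  have hinj : ∃ e : Fin (dC / 2) × Bool → Fin dC, Function.Injective e := by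
    obtain ⟨e⟩ := Function.Embedding.nonempty_of_card_le
      (α := Fin (dC / 2) × Bool) (β := Fin dC) (by simp; omega)
    exact ⟨e, e.injective⟩
  obtain ⟨e, he⟩ := hinj
  have hne : Nonempty (Fin (dC / 2)) := ⟨⟨0, by omega⟩⟩
  have hm : (dC : ℝ) ≤ 2 * (Fintype.card (Fin (dC / 2) × Bool) : ℝ) := by
    have : dC ≤ 2 * Fintype.card (Fin (dC / 2) × Bool) := by
      simp
      omega
    exact_mod_cast this
  refine not_isIndependenceTester (R := B / 100000) (ε := ε) _ ?_ ?_ hε.le ?_ ?_ ?_ ?_ (hT.comap he)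
  · linarith
  · simp
    omega
  · linarith
  · rw [Fintype.card_fin]
    have h0 : 0 ≤ B * ε := by positivity
    linarith
  · rw [Fintype.card_fin]
    set m : ℝ := (Fintype.card (Fin (dC / 2) × Bool) : ℝ)
    have h : (dA : ℝ) ^ 2 * dC ≤ (dA : ℝ) ^ 2 * (2 * m) := by gcongr
    have h0 : 0 ≤ B ^ 3 * ε ^ 4 := by positivity
    rw [div_pow]
    linarith
  · rw [Fintype.card_fin]
    set m : ℝ := (Fintype.card (Fin (dC / 2) × Bool) : ℝ)
    have h : (dA : ℝ) ^ 3 * dC ≤ (dA : ℝ) ^ 3 * (2 * m) := by gcongr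
    have h0 : 0 ≤ B ^ 4 * ε ^ 4 := by positivity
    rw [div_pow]
    linarith

end IndependenceTesting

theorem mainTheorem6 :
    ∃ c : ℝ, 0 < c ∧ ∃ k : ℕ, ∃ ε₀ : ℝ, 0 < ε₀ ∧ ε₀ ≤ 1 ∧
      ∀ (dA dC : ℕ) (ε : ℝ), 2 ≤ dC → dC ≤ dA → 0 < ε → ε ≤ ε₀ →
        ENNReal.ofReal
          (c * min ((dA : ℝ) ^ (3 / 4 : ℝ) * (dC : ℝ) ^ (1 / 4 : ℝ) / ε)
                   ((dA : ℝ) ^ (2 / 3 : ℝ) * (dC : ℝ) ^ (1 / 3 : ℝ) / ε ^ (4 / 3 : ℝ))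
            / Real.log ((dA : ℝ) * (dC : ℝ) / ε) ^ k)
        ≤ (IndependenceTesting.sampleComplexity ε dA dC : ℝ≥0∞) := by
  -- The exponent is `k = 0`: no logarithm is lost.
  refine ⟨1 / 400000, by norm_num, 0, 1 / 2000000, by norm_num, by norm_num, ?_⟩
  intro dA dC ε hC hCA hε hε1
  rw [pow_zero, div_one]
  set x := 1 / 400000 * min ((dA : ℝ) ^ (3 / 4 : ℝ) * (dC : ℝ) ^ (1 / 4 : ℝ) / ε)
    ((dA : ℝ) ^ (2 / 3 : ℝ) * (dC : ℝ) ^ (1 / 3 : ℝ) / ε ^ (4 / 3 : ℝ)) with hx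
  have h : ((⌈x⌉₊ : ℕ) : ℕ∞) ≤ IndependenceTesting.sampleComplexity ε dA dC := by
    refine le_iInf fun N => le_iInf fun ⟨T, hT⟩ => ?_
    exact Nat.cast_le.2 (Nat.ceil_le.2
      (IndependenceTesting.le_samples_of_isIndependenceTester hC hCA hε hε1 hT))
  calc ENNReal.ofReal x ≤ ENNReal.ofReal (⌈x⌉₊ : ℝ) := ENNReal.ofReal_le_ofReal (Nat.le_ceil x)
    _ = (((⌈x⌉₊ : ℕ) : ℕ∞) : ℝ≥0∞) := by simp
    _ ≤ _ := by exact_mod_cast h
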